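/- **Theorem 4.1.** Let $k$ be an algebraically closed field of characteristic zero, let $\Gamma$ and $G$ be finite groups, let $\omega:\Gamma^3\to k^*$ be a normalized 3-cocycle, and let $\mathcal C=\mathcal C(\Gamma,\omega)$ be the category of finite-dimensional $\Gamma$-graded vector spaces with associativity constraint induced by $\omega$ (acting on simple objects by $\omega(x,y,z)$ as a map $x\otimes(y\otimes z)\to (x\otimes y)\otimes z$). Let $G$ act on $\Gamma$ by group automorphisms $x\mapsto {}^gx$, and let $\tau:G\times\Gamma\times\Gamma\to k^*$, $\sigma:G\times G\times\Gamma\to k^*$ be maps with value $1$ whenever one of the arguments is an identity, such that for all $x,y,z\in\Gamma$, $g,h,l\in G$ $$\frac{\omega(x,y,z)}{\omega({}^gx,{}^gy,{}^gz)}=\frac{\tau(g;xy,z)\,\tau(g;x,y)}{\tau(g;y,z)\,\tau(g;x,yz)},\qquad 1=\frac{\sigma(h,l;x)\,\sigma(g,hl;x)}{\sigma(gh,l;x)\,\sigma(g,h;{}^lx)},\qquad \frac{\tau(gh;x,y)}{\tau(g;{}^hx,{}^hy)\,\tau(h;x,y)}=\frac{\sigma(g,h;x)\,\sigma(g,h;y)}{\sigma(g,h;xy)}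 .$$ These data define an action $\rho$ of $G$ on $\mathcal C$ by tensor autoequivalences: $\rho^g(x)={}^gx$, $\rho^g=\mathrm{id}$ on morphisms, $(\rho_2^{g,h})_x=\sigma(g,h;x)^{-1}\,\mathrm{id}:\rho^g\rho^h x\to\rho^{gh}x$ and $(\rho_2^g)_{x,y}=\tau(g;x,y)^{-1}\,\mathrm{id}:\rho^g(x\otimes y)\to\rho^gx\otimes\rho^gy$. Let $\mathcal C^G$ be the equivariantization: its objects are pairs $(X,\mu)$ with isomorphisms $\mu^g:\rho^gX\to X$ such that $\mu^g\rho^g(\mu^h)=\mu^{gh}(\rho_2^{g,h})_X$ and $\mu^e=\mathrm{id}$, and $(X,\mu)\otimes(Y,\nu)=(X\otimes Y,\,((\mu^g\otimes\nu^g)(\rho_2^g)_{X,Y})_g)$. For $y\in\Gamma$ let $G_y$ be its stabilizer in $G$ and $\sigma_y(g,h)=\sigma(g,h;y)$. A projective representation $\pi$ of a subgroup with factor set $\alpha$ satisfies $\pi(e)=\mathrm{id}$ and $\pi(gh)=\alpha(g,h)\pi(g)\pi(h)$. For an irreducible finite-dimensional projective representation $\pi$ of $G_y$ with factor set $\sigma_y$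 on $V_\pi$, let $S_{y,\pi}=\bigoplus_{t\in G/G_y}\rho^t(V_\pi\otimes y)\in\mathcal C^G$ be the simple object with the induced equivariant structure: for coset representatives $t,s$ and $gt=sh$ with $h\in G_y$, the map $\mu^g$ sends the summand of $t$ to that of $s$ by $\sigma(s,h;y)\,\sigma(g,t;y)^{-1}\,\pi(h)$. For $t\in G$ let ${}^t\pi$ be the conjugate projective representation of ${}^tG_y=tG_yt^{-1}=G_{{}^ty}$ on $V_\pi$, with factor set $\sigma_{{}^ty}$: $${}^t\pi(g)=\frac{\sigma(t,t^{-1}gt;y)}{\sigma(g,t;y)}\,\pi(t^{-1}gt).$$ For projective representations $\pi',\pi$ of a group $T$ with the same factor set, $m_T(\pi',\pi)$ is the dimension of the space of linear maps $f:V_{\pi'}\to V_\pi$ with $f\pi'(g)=\pi(g)f$ for all $g\in T$. The multiplicity of a simple object $S$ in an object $M$ of $\mathcal C^G$ is $\dim_k\mathrm{Hom}_{\mathcal C^G}(S,M)$. Let $x,y,z\in\Gamma$ and let $\delta,\pi,\gamma$ be irreducible projective representations of $G_x,G_y,G_z$ with factor sets $\sigma_x,\sigma_y,\sigma_z$. Let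 $R$ be any set of pairs $(t,s)\in G\times G$ with $x={}^ty\,{}^sz$ that represents exactly once each orbit of $G_x$, acting diagonally by left multiplication, on $\{(tG_y,sG_z)\in G/G_y\times G/G_z : x={}^ty\,{}^sz\}$. Then the multiplicity of $S_{x,\delta}$ in $S_{y,\pi}\otimes S_{z,\gamma}$ is $$\sum_{D\in G_y\backslash G/G_z}\ \sum_{\substack{(t,s)\in R\\ t^{-1}s\in D}} m_{{}^tG_y\cap{}^sG_z}\Bigl(\delta|_{{}^tG_y\cap{}^sG_z},\ {}^t\pi|_{{}^tG_y\cap{}^sG_z}\otimes{}^s\gamma|_{{}^tG_y\cap{}^sG_z}\ \tau_{{}^ty,{}^sz}^{-1}\Bigr),\qquad \tau_{{}^ty,{}^sz}(g)=\tau(g;{}^ty,{}^sz).$$ The same formula gives the fusion rules of every category of this form up to equivalence: if $\Phi:\mathcal E\to\mathcal C^G$ is a $k$-linear monoidal equivalence from a $k$-linear monoidal category $\mathcal E$, and $S_1,S_2,S_3\in\mathcal E$ satisfy $\Phi(S_1)\cong S_{x,\delta}$, $\Phi(S_2)\cong S_{y,\pi}$, $\Phi(S_3)\cong S_{z,\gamma}$,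 then $\dim_k\mathrm{Hom}_{\mathcal E}(S_1,S_2\otimes S_3)$ equals the sum above. -/

import Mathlib

open CategoryTheory MonoidalCategory TensorProduct

universe u v w w₁ w₂

noncomputable section

set_option linter.unusedSectionVars false

namespace PointedFusion

/-- A normalized 3-cocycle on `Γ` with values in `kˣ` (trivial coefficients). -/
structure Cocycle3 (k : Type u) (Γ : Type v) [Field k] [Group Γ] where
  ω : Γ → Γ → Γ → kˣ
  cocycle : ∀ a b c d : Γ,
    ω b c d * ω a (b * c) d * ω a b c = ω (a * b) c d * ω a b (c * d)
  one_left : ∀ b c, ω 1 b c = 1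
  one_mid : ∀ a c, ω a 1 c = 1
  one_right : ∀ a b, ω a b 1 = 1

section Grading

variable {k : Type u} {Γ : Type v} [Field k] [Group Γ] [Fintype Γ]

/-- A `Γ`-grading `V = ⨁ₓ Vₓ` of a vector space, recorded by its projections
`proj x : V → Vₓ ⊆ V`, a complete system of orthogonal idempotents. -/
structure Grading (k : Type u) (Γ : Type v) [Field k] [Fintype Γ]
    (V : Type*) [AddCommGroup V] [Module k V] where
  proj : Γ → V →ₗ[k] V
  proj_self : ∀ x v, proj x (proj x v) = proj x v
  proj_ne : ∀ x y, x ≠ y → ∀ v, proj x (proj y v) = 0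
  sum_proj : ∀ v, ∑ x, proj x v = v

namespace Grading

variable {T U V W M : Type*} [AddCommGroup T] [Module k T] [AddCommGroup U] [Module k U]
  [AddCommGroup V] [Module k V] [AddCommGroup W] [Module k W] [AddCommGroup M] [Module k M]

/-- `v` is homogeneous of degree `x`, that is, `v ∈ Vₓ`. -/
def Deg (P : Grading k Γ V) (x : Γ) (v : V) : Prop := P.proj x v = v

variable {O : Grading k Γ T} {N : Grading k Γ U} {P : Grading k Γ V} {Q : Grading k Γ W}
  {R : Grading k Γ M}

theorem deg_proj (P : Grading k Γ V) (x : Γ) (v : V) : P.Deg x (P.proj x v) := P.proj_self x v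

open Classical in
theorem Deg.proj {x : Γ} {v : V} (h : P.Deg x v) (y : Γ) :
    P.proj y v = if y = x then v else 0 := by
  split_ifs with e
  · rw [e]; exact h
  · rw [← h]; exact P.proj_ne y x e v

theorem Deg.smul {x : Γ} {v : V} (h : P.Deg x v) (r : k) : P.Deg x (r • v) := by
  unfold Deg at *; rw [map_smul, h]

theorem ext₁ (P : Grading k Γ V) {f g : V →ₗ[k] M} (h : ∀ x v, P.Deg x v → f v = g v) :
    f = g := by
  ext v
  rw [← P.sum_proj v, map_sum, map_sum]
  exact Finset.sum_congr rfl fun x _ => h x _ (P.deg_proj x v)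

theorem ext₂ (P : Grading k Γ V) (Q : Grading k Γ W) {f g : V ⊗[k] W →ₗ[k] M}
    (h : ∀ x v y w, P.Deg x v → Q.Deg y w → f (v ⊗ₜ w) = g (v ⊗ₜ w)) : f = g := by
  apply TensorProduct.ext
  apply P.ext₁
  intro x v hv
  apply Q.ext₁
  intro y w hw
  exact h x v y w hv hw

theorem ext₃ (N : Grading k Γ U) (P : Grading k Γ V) (Q : Grading k Γ W)
    {f g : (U ⊗[k] V) ⊗[k] W →ₗ[k] M}
    (h : ∀ a u x v y w, N.Deg a u → P.Deg x v → Q.Deg y w →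
      f ((u ⊗ₜ v) ⊗ₜ w) = g ((u ⊗ₜ v) ⊗ₜ w)) : f = g := by
  apply TensorProduct.ext
  apply N.ext₂ P
  intro a u x v hu hv
  apply Q.ext₁
  intro y w hw
  exact h a u x v y w hu hv hw

theorem ext₃' (N : Grading k Γ U) (P : Grading k Γ V) (Q : Grading k Γ W)
    {f g : U ⊗[k] (V ⊗[k] W) →ₗ[k] M}
    (h : ∀ a u x v y w, N.Deg a u → P.Deg x v → Q.Deg y w →
      f (u ⊗ₜ (v ⊗ₜ w)) = g (u ⊗ₜ (v ⊗ₜ w))) : f = g := by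
  apply TensorProduct.ext
  apply N.ext₁
  intro a u hu
  apply P.ext₂ Q
  intro x v y w hv hw
  exact h a u x v y w hu hv hw

theorem ext₄ (O : Grading k Γ T) (N : Grading k Γ U) (P : Grading k Γ V) (Q : Grading k Γ W)
    {f g : ((T ⊗[k] U) ⊗[k] V) ⊗[k] W →ₗ[k] M}
    (h : ∀ b t a u x v y w, O.Deg b t → N.Deg a u → P.Deg x v → Q.Deg y w →
      f (((t ⊗ₜ u) ⊗ₜ v) ⊗ₜ w) = g (((t ⊗ₜ u) ⊗ₜ v) ⊗ₜ w)) : f = g := by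
  apply TensorProduct.ext
  apply O.ext₃ N P
  intro b t a u x v ht hu hv
  apply Q.ext₁
  intro y w hw
  exact h b t a u x v y w ht hu hv hw

/-- Multiplication by the scalar `f x` in degree `x`. -/
def scale₁ (P : Grading k Γ V) (f : Γ → kˣ) : V →ₗ[k] V := ∑ x, (f x : k) • P.proj x

/-- Multiplication by the scalar `f x y` on `Vₓ ⊗ W_y`. -/
def scale₂ (P : Grading k Γ V) (Q : Grading k Γ W) (f : Γ → Γ → kˣ) :
    V ⊗[k] W →ₗ[k] V ⊗[k] W :=
  ∑ x, ∑ y, (f x y : k) • TensorProduct.map (P.proj x) (Q.proj y)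

/-- Multiplication by the scalar `f x y z` on `(Uₓ ⊗ V_y) ⊗ W_z`. -/
def scale₃ (N : Grading k Γ U) (P : Grading k Γ V) (Q : Grading k Γ W) (f : Γ → Γ → Γ → kˣ) :
    (U ⊗[k] V) ⊗[k] W →ₗ[k] (U ⊗[k] V) ⊗[k] W :=
  ∑ x, ∑ y, ∑ z,
    (f x y z : k) • TensorProduct.map (TensorProduct.map (N.proj x) (P.proj y)) (Q.proj z)

theorem scale₁_apply (f : Γ → kˣ) {x : Γ} {v : V} (hv : P.Deg x v) :
    P.scale₁ f v = (f x : k) • v := by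
  classical
  simp [scale₁, LinearMap.sum_apply, hv.proj]

theorem scale₂_apply (f : Γ → Γ → kˣ) {x y : Γ} {v : V} {w : W} (hv : P.Deg x v)
    (hw : Q.Deg y w) : P.scale₂ Q f (v ⊗ₜ w) = (f x y : k) • (v ⊗ₜ w) := by
  classical
  simp only [scale₂, LinearMap.sum_apply, LinearMap.smul_apply, TensorProduct.map_tmul, hv.proj,
    hw.proj]
  rw [Finset.sum_eq_single x, Finset.sum_eq_single y] <;> simp +contextual

theorem scale₃_apply (f : Γ → Γ → Γ → kˣ) {a x y : Γ} {u : U} {v : V} {w : W} (hu : N.Deg a u)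
    (hv : P.Deg x v) (hw : Q.Deg y w) :
    N.scale₃ P Q f ((u ⊗ₜ v) ⊗ₜ w) = (f a x y : k) • ((u ⊗ₜ v) ⊗ₜ w) := by
  classical
  simp only [scale₃, LinearMap.sum_apply, LinearMap.smul_apply, TensorProduct.map_tmul, hv.proj,
    hw.proj, hu.proj]
  rw [Finset.sum_eq_single a, Finset.sum_eq_single x, Finset.sum_eq_single y] <;>
    simp +contextual

theorem scale₁_inv (P : Grading k Γ V) (f : Γ → kˣ) :
    P.scale₁ f ∘ₗ P.scale₁ f⁻¹ = LinearMap.id ∧ P.scale₁ f⁻¹ ∘ₗ P.scale₁ f = LinearMap.id := by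
  constructor <;> apply P.ext₁ <;> intro x v hv <;> simp [scale₁_apply _ hv, smul_smul]

theorem scale₂_inv (P : Grading k Γ V) (Q : Grading k Γ W) (f : Γ → Γ → kˣ) :
    P.scale₂ Q f ∘ₗ P.scale₂ Q f⁻¹ = LinearMap.id ∧
      P.scale₂ Q f⁻¹ ∘ₗ P.scale₂ Q f = LinearMap.id := by
  constructor <;> apply P.ext₂ Q <;> intro x v y w hv hw <;>
    simp [scale₂_apply _ hv hw, smul_smul]

/-- The projections of the tensor product: `(V ⊗ W)_z = ⨁_{xy = z} Vₓ ⊗ W_y`. -/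
def tensorProj (P : Grading k Γ V) (Q : Grading k Γ W) (z : Γ) : V ⊗[k] W →ₗ[k] V ⊗[k] W :=
  ∑ x, TensorProduct.map (P.proj x) (Q.proj (x⁻¹ * z))

open Classical in
theorem tensorProj_apply {x y : Γ} {v : V} {w : W} (hv : P.Deg x v) (hw : Q.Deg y w) (z : Γ) :
    P.tensorProj Q z (v ⊗ₜ w) = if z = x * y then v ⊗ₜ w else 0 := by
  simp only [tensorProj, LinearMap.sum_apply, TensorProduct.map_tmul, hv.proj, hw.proj]
  rw [Finset.sum_eq_single x]
  · by_cases h : z = x * y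
    · simp [h]
    · have h' : x⁻¹ * z ≠ y := fun e => h (by rw [← e, mul_inv_cancel_left])
      simp [h, h']
  · simp +contextual
  · simp

/-- The grading of the tensor product. -/
def tensor (P : Grading k Γ V) (Q : Grading k Γ W) : Grading k Γ (V ⊗[k] W) where
  proj := P.tensorProj Q
  proj_self z t := by
    refine LinearMap.congr_fun (f := P.tensorProj Q z ∘ₗ P.tensorProj Q z) ?_ t
    apply P.ext₂ Q
    intro x v y w hv hw
    by_cases h : z = x * y <;> simp [tensorProj_apply hv hw, h]
  proj_ne z z' hz t := by
    refine LinearMap.congr_fun (f := P.tensorProj Q z ∘ₗ P.tensorProj Q z') (g := 0) ?_ t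
    apply P.ext₂ Q
    intro x v y w hv hw
    by_cases h : z' = x * y
    · subst h; simp [tensorProj_apply hv hw, hz]
    · simp [tensorProj_apply hv hw, h]
  sum_proj t := by
    have : ∑ z, P.tensorProj Q z = LinearMap.id := by
      apply P.ext₂ Q
      intro x v y w hv hw
      simp only [LinearMap.sum_apply, tensorProj_apply hv hw, LinearMap.id_apply]
      rw [Finset.sum_eq_single (x * y)] <;> simp +contextual
    simpa [LinearMap.sum_apply] using LinearMap.congr_fun this t

theorem Deg.tmul {x y : Γ} {v : V} {w : W} (hv : P.Deg x v) (hw : Q.Deg y w) :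
    (P.tensor Q).Deg (x * y) (v ⊗ₜ w) := by
  change P.tensorProj Q (x * y) (v ⊗ₜ w) = _
  simp [tensorProj_apply hv hw]

/-- The grading of `k` concentrated in degree `1`. -/
def unit : Grading k Γ k where
  proj x := by classical exact if x = 1 then LinearMap.id else 0
  proj_self x v := by split_ifs <;> simp
  proj_ne x y h v := by
    by_cases hx : x = 1
    · have hy : y ≠ 1 := fun e => h (hx.trans e.symm)
      simp [hy]
    · simp [hx]
  sum_proj v := by
    classical
    rw [Finset.sum_eq_single 1] <;> simp +contextual

theorem deg_unit (r : k) : (unit : Grading k Γ k).Deg 1 r := by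
  simp [Deg, unit]

theorem ext_unit₁ (Q : Grading k Γ W) {f g : k ⊗[k] W →ₗ[k] M}
    (h : ∀ y w, Q.Deg y w → f (1 ⊗ₜ w) = g (1 ⊗ₜ w)) : f = g := by
  apply TensorProduct.ext
  ext w
  exact LinearMap.congr_fun (Q.ext₁ (f := f ∘ₗ TensorProduct.mk k k W 1)
    (g := g ∘ₗ TensorProduct.mk k k W 1) h) w

theorem ext_unit₂ (Q : Grading k Γ W) {f g : W ⊗[k] k →ₗ[k] M}
    (h : ∀ y w, Q.Deg y w → f (w ⊗ₜ 1) = g (w ⊗ₜ 1)) : f = g := by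
  apply TensorProduct.ext
  apply Q.ext₁
  intro y w hw
  ext
  exact h y w hw

theorem comm_of_ext {f : V →ₗ[k] M} (h : ∀ z, f ∘ₗ P.proj z = R.proj z ∘ₗ f) :
    ∀ x v, P.Deg x v → R.Deg x (f v) := fun x v hv => by
  have := LinearMap.congr_fun (h x) v
  simp only [LinearMap.comp_apply] at this
  rw [hv] at this
  exact this.symm

theorem deg_of₁ {f : V →ₗ[k] M} (h : ∀ x v, P.Deg x v → R.Deg x (f v)) (z : Γ) :
    f ∘ₗ P.proj z = R.proj z ∘ₗ f := by
  apply P.ext₁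
  intro x v hv
  by_cases e : z = x <;> simp [hv.proj, (h x v hv).proj, e]

theorem deg_of₂ {f : V ⊗[k] W →ₗ[k] M}
    (h : ∀ x v y w, P.Deg x v → Q.Deg y w → R.Deg (x * y) (f (v ⊗ₜ w))) :
    ∀ z t, (P.tensor Q).Deg z t → R.Deg z (f t) := by
  apply comm_of_ext
  intro z
  apply P.ext₂ Q
  intro x v y w hv hw
  by_cases e : z = x * y <;>
    simp [(hv.tmul hw).proj, (h x v y w hv hw).proj, e]

theorem deg_of₃ {f : (U ⊗[k] V) ⊗[k] W →ₗ[k] M}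
    (h : ∀ a u x v y w, N.Deg a u → P.Deg x v → Q.Deg y w →
      R.Deg (a * x * y) (f ((u ⊗ₜ v) ⊗ₜ w))) :
    ∀ z t, ((N.tensor P).tensor Q).Deg z t → R.Deg z (f t) := by
  apply comm_of_ext
  intro z
  apply N.ext₃ P Q
  intro a u x v y w hu hv hw
  by_cases e : z = a * x * y <;>
    simp [((hu.tmul hv).tmul hw).proj, (h a u x v y w hu hv hw).proj, e]

theorem deg_of₃' {f : U ⊗[k] (V ⊗[k] W) →ₗ[k] M}
    (h : ∀ a u x v y w, N.Deg a u → P.Deg x v → Q.Deg y w →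
      R.Deg (a * (x * y)) (f (u ⊗ₜ (v ⊗ₜ w)))) :
    ∀ z t, (N.tensor (P.tensor Q)).Deg z t → R.Deg z (f t) := by
  apply comm_of_ext
  intro z
  apply N.ext₃' P Q
  intro a u x v y w hu hv hw
  by_cases e : z = a * (x * y) <;>
    simp [(hu.tmul (hv.tmul hw)).proj, (h a u x v y w hu hv hw).proj, e]

/-- The associativity constraint induced by `ω`: multiplication by `ω(x, y, z)⁻¹`
from `(Uₓ ⊗ V_y) ⊗ W_z` to `Uₓ ⊗ (V_y ⊗ W_z)`, that is, by `ω(x, y, z)` in the other direction. -/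
def assocLin (ω : Γ → Γ → Γ → kˣ) (N : Grading k Γ U) (P : Grading k Γ V) (Q : Grading k Γ W) :
    (U ⊗[k] V) ⊗[k] W →ₗ[k] U ⊗[k] (V ⊗[k] W) :=
  (TensorProduct.assoc k U V W).toLinearMap ∘ₗ N.scale₃ P Q fun x y z => (ω x y z)⁻¹

/-- The inverse of the associativity constraint. -/
def assocInvLin (ω : Γ → Γ → Γ → kˣ) (N : Grading k Γ U) (P : Grading k Γ V)
    (Q : Grading k Γ W) : U ⊗[k] (V ⊗[k] W) →ₗ[k] (U ⊗[k] V) ⊗[k] W :=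
  N.scale₃ P Q ω ∘ₗ (TensorProduct.assoc k U V W).symm.toLinearMap

theorem assocLin_apply (ω : Γ → Γ → Γ → kˣ) {a x y : Γ} {u : U} {v : V} {w : W}
    (hu : N.Deg a u) (hv : P.Deg x v) (hw : Q.Deg y w) :
    assocLin ω N P Q ((u ⊗ₜ v) ⊗ₜ w) = (((ω a x y)⁻¹ : kˣ) : k) • (u ⊗ₜ (v ⊗ₜ w)) := by
  simp [assocLin, scale₃_apply _ hu hv hw]

theorem assocInvLin_apply (ω : Γ → Γ → Γ → kˣ) {a x y : Γ} {u : U} {v : V} {w : W}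
    (hu : N.Deg a u) (hv : P.Deg x v) (hw : Q.Deg y w) :
    assocInvLin ω N P Q (u ⊗ₜ (v ⊗ₜ w)) = (ω a x y : k) • ((u ⊗ₜ v) ⊗ₜ w) := by
  simp [assocInvLin, scale₃_apply _ hu hv hw]

end Grading
end Grading

section Category

variable {k : Type u} {Γ : Type v} [Field k] [Group Γ] [Fintype Γ]

/-- The objects of `C(Γ, ω)`: finite-dimensional `Γ`-graded vector spaces. (The cocycle is a
parameter because it enters in the associativity constraint.) -/
structure VecGr (c : Cocycle3 k Γ) where
  carrier : Type u
  [acg : AddCommGroup carrier]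
  [mod : Module k carrier]
  [fd : FiniteDimensional k carrier]
  gr : Grading k Γ carrier

attribute [instance] VecGr.acg VecGr.mod VecGr.fd

variable {c : Cocycle3 k Γ}

namespace VecGr

/-- Morphisms are the linear maps `f` with `f(Vₓ) ⊆ Wₓ`. -/
@[ext]
structure Hom (V W : VecGr c) where
  lin : V.carrier →ₗ[k] W.carrier
  deg : ∀ x v, V.gr.Deg x v → W.gr.Deg x (lin v)

instance : Category (VecGr c) where
  Hom := Hom
  id V := ⟨LinearMap.id, fun _ _ h => h⟩
  comp f g := ⟨g.lin ∘ₗ f.lin, fun x v h => g.deg x _ (f.deg x v h)⟩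

/-- The underlying linear map of a morphism. -/
def lin {V W : VecGr c} (f : V ⟶ W) : V.carrier →ₗ[k] W.carrier := Hom.lin f

theorem lin_deg {V W : VecGr c} (f : V ⟶ W) {x : Γ} {v : V.carrier} (h : V.gr.Deg x v) :
    W.gr.Deg x (lin f v) := Hom.deg f x v h

theorem hom_ext {V W : VecGr c} {f g : V ⟶ W} (h : lin f = lin g) : f = g := Hom.ext h

/-- Constructor for morphisms. -/
def mkHom {V W : VecGr c} (f : V.carrier →ₗ[k] W.carrier)
    (h : ∀ x v, V.gr.Deg x v → W.gr.Deg x (f v)) : V ⟶ W := ⟨f, h⟩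

@[simp] theorem lin_id (V : VecGr c) : lin (𝟙 V) = LinearMap.id := rfl

@[simp] theorem lin_comp {U V W : VecGr c} (f : U ⟶ V) (g : V ⟶ W) :
    lin (f ≫ g) = lin g ∘ₗ lin f := rfl

@[simp] theorem lin_mkHom {V W : VecGr c} (f : V.carrier →ₗ[k] W.carrier)
    (h : ∀ x v, V.gr.Deg x v → W.gr.Deg x (f v)) : lin (mkHom f h) = f := rfl

/-- Mutually inverse graded maps form an isomorphism. -/
def mkIso {V W : VecGr c} (f : V.carrier →ₗ[k] W.carrier) (g : W.carrier →ₗ[k] V.carrier)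
    (hf : ∀ x v, V.gr.Deg x v → W.gr.Deg x (f v)) (hg : ∀ x w, W.gr.Deg x w → V.gr.Deg x (g w))
    (hgf : g ∘ₗ f = LinearMap.id) (hfg : f ∘ₗ g = LinearMap.id) : V ≅ W where
  hom := mkHom f hf
  inv := mkHom g hg
  hom_inv_id := hom_ext hgf
  inv_hom_id := hom_ext hfg

@[simp] theorem lin_mkIso_hom {V W : VecGr c} (f : V.carrier →ₗ[k] W.carrier)
    (g : W.carrier →ₗ[k] V.carrier) (hf : ∀ x v, V.gr.Deg x v → W.gr.Deg x (f v))
    (hg : ∀ x w, W.gr.Deg x w → V.gr.Deg x (g w))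
    (hgf : g ∘ₗ f = LinearMap.id) (hfg : f ∘ₗ g = LinearMap.id) :
    lin (mkIso f g hf hg hgf hfg).hom = f := rfl

@[simp] theorem lin_mkIso_inv {V W : VecGr c} (f : V.carrier →ₗ[k] W.carrier)
    (g : W.carrier →ₗ[k] V.carrier) (hf : ∀ x v, V.gr.Deg x v → W.gr.Deg x (f v))
    (hg : ∀ x w, W.gr.Deg x w → V.gr.Deg x (g w))
    (hgf : g ∘ₗ f = LinearMap.id) (hfg : f ∘ₗ g = LinearMap.id) :
    lin (mkIso f g hf hg hgf hfg).inv = g := rfl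

theorem isIso_of_bijective {V W : VecGr c} (f : V ⟶ W) (h : Function.Bijective (lin f)) :
    IsIso f := by
  let e := LinearEquiv.ofBijective (lin f) h
  refine ⟨mkHom e.symm.toLinearMap ?_, hom_ext ?_, hom_ext ?_⟩
  · apply Grading.comm_of_ext
    intro z
    ext w
    apply e.injective
    have := LinearMap.congr_fun
      (Grading.deg_of₁ (P := V.gr) (R := W.gr) (f := lin f) (fun x v hv => lin_deg f hv) z)
      (e.symm w)
    simp only [LinearMap.comp_apply, LinearEquiv.coe_coe, LinearEquiv.apply_symm_apply]
    refine Eq.trans ?_ this.symm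
    change _ = W.gr.proj z (e (e.symm w))
    rw [LinearEquiv.apply_symm_apply]
  · ext v; exact e.symm_apply_apply v
  · ext v; exact e.apply_symm_apply v

/-- Bundling a graded vector space. -/
abbrev of (c : Cocycle3 k Γ) (V : Type u) [AddCommGroup V] [Module k V] [FiniteDimensional k V]
    (P : Grading k Γ V) : VecGr c := ⟨V, P⟩

instance (V W : VecGr c) : AddCommGroup (V ⟶ W) :=
  let inj : (V ⟶ W) → (V.carrier →ₗ[k] W.carrier) := lin
  letI : Zero (V ⟶ W) := ⟨mkHom 0 fun _ _ _ => by simp [Grading.Deg]⟩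
  letI : Add (V ⟶ W) := ⟨fun f g => mkHom (lin f + lin g) fun x v h => by
    have hf := lin_deg f h
    have hg := lin_deg g h
    simp only [Grading.Deg] at hf hg
    simp [Grading.Deg, hf, hg]⟩
  letI : Neg (V ⟶ W) := ⟨fun f => mkHom (- lin f) fun x v h => by
    have hf := lin_deg f h
    simp only [Grading.Deg] at hf
    simp [Grading.Deg, hf]⟩
  letI : Sub (V ⟶ W) := ⟨fun f g => mkHom (lin f - lin g) fun x v h => by
    have hf := lin_deg f h
    have hg := lin_deg g h
    simp only [Grading.Deg] at hf hg
    simp [Grading.Deg, hf, hg]⟩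
  letI : SMul ℕ (V ⟶ W) := ⟨fun n f => mkHom (n • lin f) fun x v h => by
    have hf := lin_deg f h
    simp only [Grading.Deg] at hf
    simp [Grading.Deg, hf]⟩
  letI : SMul ℤ (V ⟶ W) := ⟨fun n f => mkHom (n • lin f) fun x v h => by
    have hf := lin_deg f h
    simp only [Grading.Deg] at hf
    simp [Grading.Deg, hf]⟩
  Function.Injective.addCommGroup inj (fun _ _ h => hom_ext h) rfl (fun _ _ => rfl)
    (fun _ => rfl) (fun _ _ => rfl) (fun _ _ => rfl) (fun _ _ => rfl)

@[simp] theorem lin_add {V W : VecGr c} (f g : V ⟶ W) : lin (f + g) = lin f + lin g := rfl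

@[simp] theorem lin_zero {V W : VecGr c} : lin (0 : V ⟶ W) = 0 := rfl

/-- `lin` as an additive map. -/
def linHom (V W : VecGr c) : (V ⟶ W) →+ (V.carrier →ₗ[k] W.carrier) where
  toFun := lin
  map_zero' := rfl
  map_add' _ _ := rfl

instance (V W : VecGr c) : Module k (V ⟶ W) :=
  letI : SMul k (V ⟶ W) := ⟨fun r f => mkHom (r • lin f) fun x v h => by
    have hf := lin_deg f h
    simp only [Grading.Deg] at hf
    simp [Grading.Deg, hf]⟩
  Function.Injective.module k (linHom V W) (fun _ _ h => hom_ext h) (fun _ _ => rfl)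

@[simp] theorem lin_smul {V W : VecGr c} (r : k) (f : V ⟶ W) : lin (r • f) = r • lin f := rfl

instance : Preadditive (VecGr c) where
  add_comp _ _ _ _ _ _ := hom_ext (by simp [LinearMap.comp_add])
  comp_add _ _ _ _ _ _ := hom_ext (by simp [LinearMap.add_comp])

instance : Linear k (VecGr c) where
  smul_comp _ _ _ _ _ _ := hom_ext (by simp [LinearMap.comp_smul])
  comp_smul _ _ _ _ _ _ := hom_ext (by simp [LinearMap.smul_comp])

/-- The tensor product of graded maps. -/
def tensorMap {V V' W W' : VecGr c} (f : V ⟶ V') (g : W ⟶ W') :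
    of c (V.carrier ⊗[k] W.carrier) (V.gr.tensor W.gr) ⟶
      of c (V'.carrier ⊗[k] W'.carrier) (V'.gr.tensor W'.gr) :=
  mkHom (TensorProduct.map (lin f) (lin g)) <| Grading.deg_of₂ fun _ _ _ _ hv hw => by
    simpa using (lin_deg f hv).tmul (lin_deg g hw)

instance : MonoidalCategoryStruct (VecGr c) where
  tensorObj V W := of c (V.carrier ⊗[k] W.carrier) (V.gr.tensor W.gr)
  tensorUnit := of c k Grading.unit
  tensorHom f g := tensorMap f g
  whiskerLeft V _ _ g := tensorMap (𝟙 V) g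
  whiskerRight f W := tensorMap f (𝟙 W)
  associator U V W := mkIso (Grading.assocLin c.ω U.gr V.gr W.gr)
    (Grading.assocInvLin c.ω U.gr V.gr W.gr)
    (Grading.deg_of₃ fun a u x v y w hu hv hw => by
      rw [Grading.assocLin_apply _ hu hv hw, mul_assoc]
      exact (hu.tmul (hv.tmul hw)).smul _)
    (Grading.deg_of₃' fun a u x v y w hu hv hw => by
      rw [Grading.assocInvLin_apply _ hu hv hw, ← mul_assoc]
      exact ((hu.tmul hv).tmul hw).smul _)
    (Grading.ext₃ U.gr V.gr W.gr fun a u x v y w hu hv hw => by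
      simp [Grading.assocLin_apply _ hu hv hw, Grading.assocInvLin_apply _ hu hv hw, smul_smul])
    (Grading.ext₃' U.gr V.gr W.gr fun a u x v y w hu hv hw => by
      simp [Grading.assocLin_apply _ hu hv hw, Grading.assocInvLin_apply _ hu hv hw, smul_smul])
  leftUnitor V := mkIso (TensorProduct.lid k V.carrier).toLinearMap
    (TensorProduct.lid k V.carrier).symm.toLinearMap
    (Grading.deg_of₂ fun x r y v hr hv => by
      by_cases h : x = 1
      · subst h; simpa using hv.smul r
      · have : r = 0 := by rw [← hr]; simp [Grading.unit, h]
        simp [this, Grading.Deg])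
    (fun x v hv => by simpa using (Grading.deg_unit 1).tmul hv)
    (by ext; simp) (by ext; simp)
  rightUnitor V := mkIso (TensorProduct.rid k V.carrier).toLinearMap
    (TensorProduct.rid k V.carrier).symm.toLinearMap
    (Grading.deg_of₂ fun y v x r hv hr => by
      by_cases h : x = 1
      · subst h; simpa using hv.smul r
      · have : r = 0 := by rw [← hr]; simp [Grading.unit, h]
        simp [this, Grading.Deg])
    (fun x v hv => by simpa using hv.tmul (Grading.deg_unit 1))
    (by ext; simp) (by ext; simp)

theorem lin_tensorHom {V V' W W' : VecGr c} (f : V ⟶ V') (g : W ⟶ W') :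
    lin (f ⊗ₘ g) = TensorProduct.map (lin f) (lin g) := rfl

theorem lin_assoc (U V W : VecGr c) :
    lin (α_ U V W).hom = Grading.assocLin c.ω U.gr V.gr W.gr := rfl

/-- `C(Γ, ω)` is a monoidal category. -/
instance : MonoidalCategory (VecGr c) := MonoidalCategory.ofTensorHom
  (id_tensorHom_id := fun V W => hom_ext (TensorProduct.map_id))
  (id_tensorHom := fun _ _ _ _ => rfl)
  (tensorHom_id := fun _ _ => rfl)
  (tensorHom_comp_tensorHom := fun f₁ f₂ g₁ g₂ => hom_ext
    (TensorProduct.map_comp (lin g₁) (lin g₂) (lin f₁) (lin f₂)).symm)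
  (associator_naturality := fun {X₁ X₂ X₃ Y₁ Y₂ Y₃} f₁ f₂ f₃ => hom_ext <| by
    refine Grading.ext₃ X₁.gr X₂.gr X₃.gr fun a u x v y w hu hv hw => ?_
    change Grading.assocLin c.ω Y₁.gr Y₂.gr Y₃.gr ((lin f₁ u ⊗ₜ lin f₂ v) ⊗ₜ lin f₃ w) =
      TensorProduct.map (lin f₁) (TensorProduct.map (lin f₂) (lin f₃))
        (Grading.assocLin c.ω X₁.gr X₂.gr X₃.gr ((u ⊗ₜ v) ⊗ₜ w))
    rw [Grading.assocLin_apply _ hu hv hw,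
      Grading.assocLin_apply _ (lin_deg f₁ hu) (lin_deg f₂ hv) (lin_deg f₃ hw)]
    simp)
  (leftUnitor_naturality := fun {X Y} f => hom_ext <| by
    refine Grading.ext_unit₁ X.gr fun y w _ => ?_
    change TensorProduct.lid k Y.carrier ((1 : k) ⊗ₜ lin f w) =
      lin f (TensorProduct.lid k X.carrier ((1 : k) ⊗ₜ w))
    simp)
  (rightUnitor_naturality := fun {X Y} f => hom_ext <| by
    refine Grading.ext_unit₂ X.gr fun y w _ => ?_
    change TensorProduct.rid k Y.carrier (lin f w ⊗ₜ (1 : k)) =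
      lin f (TensorProduct.rid k X.carrier (w ⊗ₜ (1 : k)))
    simp)
  (pentagon := fun W X Y Z => hom_ext <| by
    refine Grading.ext₄ W.gr X.gr Y.gr Z.gr fun b t a u x v y w ht hu hv hw => ?_
    change TensorProduct.map LinearMap.id (Grading.assocLin c.ω X.gr Y.gr Z.gr)
        (Grading.assocLin c.ω W.gr (X.gr.tensor Y.gr) Z.gr
          (Grading.assocLin c.ω W.gr X.gr Y.gr ((t ⊗ₜ u) ⊗ₜ v) ⊗ₜ w)) =
      Grading.assocLin c.ω W.gr X.gr (Y.gr.tensor Z.gr)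
        (Grading.assocLin c.ω (W.gr.tensor X.gr) Y.gr Z.gr (((t ⊗ₜ u) ⊗ₜ v) ⊗ₜ w))
    rw [Grading.assocLin_apply _ ht hu hv, ← TensorProduct.smul_tmul', map_smul,
      Grading.assocLin_apply _ ht (hu.tmul hv) hw,
      Grading.assocLin_apply _ (ht.tmul hu) hv hw, map_smul, map_smul, map_smul,
      Grading.assocLin_apply _ ht hu (hv.tmul hw), TensorProduct.map_tmul,
      Grading.assocLin_apply _ hu hv hw, LinearMap.id_apply, TensorProduct.tmul_smul, smul_smul,
      smul_smul, smul_smul]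
    congr 1
    have := congrArg (fun r : kˣ => ((r⁻¹ : kˣ) : k)) (c.cocycle b a x y)
    simp only [mul_inv, Units.val_mul] at this
    linear_combination this)
  (triangle := fun X Y => hom_ext <| by
    refine Grading.ext₃ X.gr Grading.unit Y.gr fun a u x r y w hu hr hw => ?_
    change TensorProduct.map LinearMap.id (TensorProduct.lid k Y.carrier).toLinearMap
        (Grading.assocLin c.ω X.gr Grading.unit Y.gr ((u ⊗ₜ r) ⊗ₜ w)) =
      (TensorProduct.rid k X.carrier (u ⊗ₜ r)) ⊗ₜ w
    rw [Grading.assocLin_apply _ hu hr hw]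
    by_cases h : x = 1
    · subst h
      simp [c.one_mid, TensorProduct.smul_tmul']
    · have : r = 0 := by rw [← hr]; simp [Grading.unit, h]
      simp [this])

end VecGr
end Category

section Action

variable {k : Type u} {Γ : Type v} [Field k] [Group Γ] [Fintype Γ]

/-- The data of an action of `G` on `C(Γ, ω)` by tensor autoequivalences: an action of `G` on `Γ`
by group automorphisms (the `MulDistribMulAction` instance) and normalized maps `τ`, `σ`
subject to the compatibility conditions. -/
structure ActionData (c : Cocycle3 k Γ) (G : Type w) [Group G] [MulDistribMulAction G Γ] where
  τ : G → Γ → Γ → kˣ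
  σ : G → G → Γ → kˣ
  ω_τ : ∀ (g : G) (x y z : Γ), c.ω x y z / c.ω (g • x) (g • y) (g • z) =
    (τ g (x * y) z * τ g x y) / (τ g y z * τ g x (y * z))
  σ_σ : ∀ (g h l : G) (x : Γ),
    1 = (σ h l x * σ g (h * l) x) / (σ (g * h) l x * σ g h (l • x))
  τ_σ : ∀ (g h : G) (x y : Γ), τ (g * h) x y / (τ g (h • x) (h • y) * τ h x y) =
    (σ g h x * σ g h y) / σ g h (x * y)
  τ_one : ∀ x y, τ 1 x y = 1
  τ_one_left : ∀ g y, τ g 1 y = 1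
  τ_one_right : ∀ g x, τ g x 1 = 1
  σ_one_left : ∀ h x, σ 1 h x = 1
  σ_one_right : ∀ g x, σ g 1 x = 1
  σ_one : ∀ g h, σ g h 1 = 1

variable {c : Cocycle3 k Γ} {G : Type w} [Group G] [MulDistribMulAction G Γ]

/-- The grading of `ρ^g V`: the space `V` with `(ρ^g V)_{gx} = Vₓ`. -/
def Grading.shift {V : Type*} [AddCommGroup V] [Module k V] (P : Grading k Γ V) (g : G) :
    Grading k Γ V where
  proj x := P.proj (g⁻¹ • x)
  proj_self x := P.proj_self _
  proj_ne x y h := P.proj_ne _ _ fun e => h (by simpa using e)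
  sum_proj v := by
    conv_rhs => rw [← P.sum_proj v]
    exact Fintype.sum_equiv (MulAction.toPerm g⁻¹) _ _ fun _ => rfl

theorem Grading.deg_shift {V : Type*} [AddCommGroup V] [Module k V] {P : Grading k Γ V} {g : G}
    {x : Γ} {v : V} : (P.shift g).Deg x v ↔ P.Deg (g⁻¹ • x) v := Iff.rfl

theorem Grading.Deg.shift {V : Type*} [AddCommGroup V] [Module k V] {P : Grading k Γ V}
    {x : Γ} {v : V} (h : P.Deg x v) (g : G) : (P.shift g).Deg (g • x) v := by
  rw [Grading.deg_shift, inv_smul_smul]; exact h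

namespace Grading

variable {V W : Type*} [AddCommGroup V] [Module k V] [AddCommGroup W] [Module k W]
  {P : Grading k Γ V} {Q : Grading k Γ W}

theorem deg_shift_mul {g h : G} {x : Γ} {v : V} :
    (P.shift (g * h)).Deg x v ↔ ((P.shift h).shift g).Deg x v := by
  rw [deg_shift, deg_shift, deg_shift, mul_inv_rev, mul_smul]

theorem deg_shift_one {x : Γ} {v : V} : (P.shift (1 : G)).Deg x v ↔ P.Deg x v := by
  rw [deg_shift, inv_one, one_smul]

theorem Deg.scale₁ {x y : Γ} {v : V} (h : P.Deg x v) {R : Grading k Γ V} (f : Γ → kˣ)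
    (hR : R.Deg y v) : R.Deg y (P.scale₁ f v) := by
  rw [scale₁_apply _ h]; exact hR.smul _

theorem deg_shift_tensor (f : Γ → Γ → kˣ) (g : G) (z : Γ) (t : V ⊗[k] W)
    (ht : ((P.tensor Q).shift g).Deg z t) :
    ((P.shift g).tensor (Q.shift g)).Deg z (P.scale₂ Q f t) := by
  have := deg_of₂ (P := P) (Q := Q)
    (R := ((P.shift g).tensor (Q.shift g)).shift g⁻¹)
    (f := P.scale₂ Q f) (fun x v y w hv hw => by
      rw [scale₂_apply _ hv hw]
      refine Deg.smul ?_ _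
      rw [deg_shift, inv_inv, smul_mul']
      exact (hv.shift g).tmul (hw.shift g)) _ _ ht
  rwa [deg_shift, inv_inv, smul_inv_smul] at this

theorem deg_tensor_shift (f : Γ → Γ → kˣ) (g : G) :
    ∀ (z : Γ) (t : V ⊗[k] W), ((P.shift g).tensor (Q.shift g)).Deg z t →
      ((P.tensor Q).shift g).Deg z (P.scale₂ Q f t) :=
  deg_of₂ fun x v y w hv hw => by
    rw [deg_shift] at hv hw
    rw [scale₂_apply _ hv hw, deg_shift, smul_mul']
    exact (hv.tmul hw).smul _

theorem deg_unit_shift (g : G) (x : Γ) (r : k) :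
    ((unit : Grading k Γ k).shift g).Deg x r ↔ (unit : Grading k Γ k).Deg x r := by
  have : g⁻¹ • x = 1 ↔ x = 1 := by rw [inv_smul_eq_iff, smul_one]
  rw [deg_shift]
  by_cases h : x = 1
  · simp [h]
  · have h' : g⁻¹ • x ≠ 1 := fun e => h (this.1 e)
    simp [Deg, unit, h, h']

end Grading

namespace ActionData

open VecGr

variable (A : ActionData c G)

theorem σ_mul (g h l : G) (x : Γ) :
    A.σ h l x * A.σ g (h * l) x = A.σ (g * h) l x * A.σ g h (l • x) :=
  (div_eq_one.mp (A.σ_σ g h l x).symm)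

theorem τ_mul (g h : G) (x y : Γ) : A.τ (g * h) x y * A.σ g h (x * y) =
    (A.σ g h x * A.σ g h y) * (A.τ g (h • x) (h • y) * A.τ h x y) := by
  have := A.τ_σ g h x y
  rwa [div_eq_div_iff_mul_eq_mul] at this

theorem ω_mul (g : G) (x y z : Γ) : c.ω x y z * (A.τ g y z * A.τ g x (y * z)) =
    (A.τ g (x * y) z * A.τ g x y) * c.ω (g • x) (g • y) (g • z) := by
  have := A.ω_τ g x y z
  rwa [div_eq_div_iff_mul_eq_mul] at this

/-- The functor `ρ^g`; it is the identity on the underlying linear maps. -/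
def ρ (_A : ActionData c G) (g : G) : VecGr c ⥤ VecGr c where
  obj V := of c V.carrier (V.gr.shift g)
  map {V W} f := mkHom (V := of c V.carrier (V.gr.shift g)) (W := of c W.carrier (W.gr.shift g))
    (lin (V := V) (W := W) f) fun _ _ h => lin_deg (V := V) (W := W) f h

@[simp] theorem lin_ρ_map (g : G) {V W : VecGr c} (f : V ⟶ W) :
    lin ((A.ρ g).map f) = lin f := rfl

/-- The isomorphism `ρ₂^{g,h} : ρ^g ρ^h V ≅ ρ^{gh} V`, multiplication by `σ(g, h; x)⁻¹` on `Vₓ`. -/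
def ρ₂ (g h : G) (V : VecGr c) : (A.ρ g).obj ((A.ρ h).obj V) ≅ (A.ρ (g * h)).obj V :=
  mkIso (V.gr.scale₁ (A.σ g h)⁻¹) (V.gr.scale₁ (A.σ g h))
    (fun _ _ hv => Grading.Deg.scale₁ (P := V.gr) (R := V.gr.shift (g * h)) hv _
      (Grading.deg_shift_mul.2 hv))
    (fun _ _ hv => Grading.Deg.scale₁ (P := V.gr) (R := (V.gr.shift h).shift g)
      (Grading.deg_shift_mul.1 hv) _ (Grading.deg_shift_mul.1 hv))
    (V.gr.scale₁_inv _).1 (V.gr.scale₁_inv _).2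

/-- The isomorphism `ρ₀ : V ≅ ρ^e V`, the identity of the underlying space. -/
def ρ₀ (V : VecGr c) : V ≅ (A.ρ 1).obj V :=
  mkIso (W := (A.ρ 1).obj V) LinearMap.id LinearMap.id
    (fun _ _ hv => Grading.deg_shift_one.2 hv) (fun _ _ hv => Grading.deg_shift_one.1 hv) rfl rfl

/-- The monoidal structure `(ρ₂^g)_{V,W} : ρ^g(V ⊗ W) ≅ ρ^g V ⊗ ρ^g W` of `ρ^g`, multiplication
by `τ(g; x, y)⁻¹` on `Vₓ ⊗ W_y`. -/
def tens (g : G) (V W : VecGr c) : (A.ρ g).obj (V ⊗ W) ≅ (A.ρ g).obj V ⊗ (A.ρ g).obj W :=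
  mkIso (V := (A.ρ g).obj (V ⊗ W)) (W := (A.ρ g).obj V ⊗ (A.ρ g).obj W)
    (V.gr.scale₂ W.gr (A.τ g)⁻¹) (V.gr.scale₂ W.gr (A.τ g))
    (Grading.deg_shift_tensor _ g) (Grading.deg_tensor_shift _ g)
    (V.gr.scale₂_inv W.gr _).1 (V.gr.scale₂_inv W.gr _).2

/-- The isomorphism `ρ^g 𝟙 ≅ 𝟙`, the identity of the underlying space. -/
def unitIso (g : G) : (A.ρ g).obj (𝟙_ (VecGr c)) ≅ 𝟙_ (VecGr c) :=
  mkIso (V := of c k (Grading.unit.shift g)) (W := of c k Grading.unit)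
    LinearMap.id LinearMap.id
    (fun x r hr => (Grading.deg_unit_shift g x r).1 hr)
    (fun x r hr => (Grading.deg_unit_shift g x r).2 hr) rfl rfl

@[simp] theorem lin_ρ₂_hom (g h : G) (V : VecGr c) :
    lin (A.ρ₂ g h V).hom = V.gr.scale₁ (A.σ g h)⁻¹ := rfl

@[simp] theorem lin_tens_hom (g : G) (V W : VecGr c) :
    lin (A.tens g V W).hom = V.gr.scale₂ W.gr (A.τ g)⁻¹ := rfl

/-- The maps `ρ₂^{g,h}` are natural. -/
theorem ρ₂_naturality (g h : G) {V W : VecGr c} (f : V ⟶ W) :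
    (A.ρ g).map ((A.ρ h).map f) ≫ (A.ρ₂ g h W).hom =
      (A.ρ₂ g h V).hom ≫ (A.ρ (g * h)).map f :=
  hom_ext <| V.gr.ext₁ fun x v hv => by
    change W.gr.scale₁ (A.σ g h)⁻¹ (lin f v) = lin f (V.gr.scale₁ (A.σ g h)⁻¹ v)
    rw [Grading.scale₁_apply _ hv, Grading.scale₁_apply _ (lin_deg f hv), map_smul]

/-- The maps `ρ₂^{g,h}` satisfy the associativity condition of an action. -/
theorem lin_ρ₂_assoc (a b d : G) (V : VecGr c) :
    lin (A.ρ₂ (a * b) d V).hom ∘ₗ lin (A.ρ₂ a b ((A.ρ d).obj V)).hom =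
      lin (A.ρ₂ a (b * d) V).hom ∘ₗ lin ((A.ρ a).map (A.ρ₂ b d V).hom) :=
  V.gr.ext₁ fun x v hv => by
    change V.gr.scale₁ (A.σ (a * b) d)⁻¹ ((V.gr.shift d).scale₁ (A.σ a b)⁻¹ v) =
      V.gr.scale₁ (A.σ a (b * d))⁻¹ (V.gr.scale₁ (A.σ b d)⁻¹ v)
    rw [Grading.scale₁_apply _ hv, Grading.scale₁_apply _ (hv.shift d), map_smul, map_smul,
      Grading.scale₁_apply _ hv, Grading.scale₁_apply _ hv, smul_smul, smul_smul]
    congr 1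
    have := congrArg (fun r : kˣ => ((r⁻¹ : kˣ) : k)) (A.σ_mul a b d x)
    simp only [mul_inv, Units.val_mul] at this
    simp only [Pi.inv_apply]
    linear_combination -this

/-- The maps `(ρ₂^g)_{V,W}` are natural. -/
theorem tens_naturality (g : G) {V V' W W' : VecGr c} (f : V ⟶ V') (f' : W ⟶ W') :
    (A.ρ g).map (f ⊗ₘ f') ≫ (A.tens g V' W').hom =
      (A.tens g V W).hom ≫ ((A.ρ g).map f ⊗ₘ (A.ρ g).map f') :=
  hom_ext <| V.gr.ext₂ W.gr fun x v y w hv hw => by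
    change V'.gr.scale₂ W'.gr (A.τ g)⁻¹ (lin f v ⊗ₜ lin f' w) =
      TensorProduct.map (lin f) (lin f') (V.gr.scale₂ W.gr (A.τ g)⁻¹ (v ⊗ₜ w))
    rw [Grading.scale₂_apply _ hv hw, Grading.scale₂_apply _ (lin_deg f hv) (lin_deg f' hw),
      map_smul, TensorProduct.map_tmul]

/-- The functor `ρ^g` is monoidal. -/
theorem tens_assoc (g : G) (U V W : VecGr c) :
    (A.ρ g).map (α_ U V W).hom ≫ (A.tens g U (V ⊗ W)).hom ≫
        (𝟙 ((A.ρ g).obj U) ⊗ₘ (A.tens g V W).hom) =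
      (A.tens g (U ⊗ V) W).hom ≫ ((A.tens g U V).hom ⊗ₘ 𝟙 ((A.ρ g).obj W)) ≫
        (α_ ((A.ρ g).obj U) ((A.ρ g).obj V) ((A.ρ g).obj W)).hom :=
  hom_ext <| Grading.ext₃ U.gr V.gr W.gr fun a u x v y w hu hv hw => by
    change TensorProduct.map LinearMap.id (V.gr.scale₂ W.gr (A.τ g)⁻¹)
        (U.gr.scale₂ (V.gr.tensor W.gr) (A.τ g)⁻¹
          (Grading.assocLin c.ω U.gr V.gr W.gr ((u ⊗ₜ v) ⊗ₜ w))) =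
      Grading.assocLin c.ω (U.gr.shift g) (V.gr.shift g) (W.gr.shift g)
        (TensorProduct.map (U.gr.scale₂ V.gr (A.τ g)⁻¹) LinearMap.id
          ((U.gr.tensor V.gr).scale₂ W.gr (A.τ g)⁻¹ ((u ⊗ₜ v) ⊗ₜ w)))
    rw [Grading.assocLin_apply _ hu hv hw, map_smul, Grading.scale₂_apply _ hu (hv.tmul hw),
      Grading.scale₂_apply _ (hu.tmul hv) hw, map_smul, map_smul, map_smul, map_smul,
      TensorProduct.map_tmul, TensorProduct.map_tmul, Grading.scale₂_apply _ hv hw,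
      Grading.scale₂_apply _ hu hv, ← TensorProduct.smul_tmul', map_smul,
      LinearMap.id_apply, LinearMap.id_apply,
      Grading.assocLin_apply _ (hu.shift g) (hv.shift g) (hw.shift g), TensorProduct.tmul_smul, smul_smul, smul_smul, smul_smul, smul_smul]
    congr 1
    have := congrArg (fun r : kˣ => ((r⁻¹ : kˣ) : k)) (A.ω_mul g a x y)
    simp only [mul_inv, Units.val_mul] at this
    simp only [Pi.inv_apply]
    linear_combination this

/-- The maps `ρ₂^{g,h}` are monoidal. -/
theorem tens_ρ₂ (g h : G) (V W : VecGr c) :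
    (A.ρ₂ g h (V ⊗ W)).hom ≫ (A.tens (g * h) V W).hom =
      (A.ρ g).map (A.tens h V W).hom ≫ (A.tens g ((A.ρ h).obj V) ((A.ρ h).obj W)).hom ≫
        ((A.ρ₂ g h V).hom ⊗ₘ (A.ρ₂ g h W).hom) :=
  hom_ext <| V.gr.ext₂ W.gr fun x v y w hv hw => by
    change V.gr.scale₂ W.gr (A.τ (g * h))⁻¹
        ((V.gr.tensor W.gr).scale₁ (A.σ g h)⁻¹ (v ⊗ₜ w)) =
      TensorProduct.map (V.gr.scale₁ (A.σ g h)⁻¹) (W.gr.scale₁ (A.σ g h)⁻¹)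
        ((V.gr.shift h).scale₂ (W.gr.shift h) (A.τ g)⁻¹
          (V.gr.scale₂ W.gr (A.τ h)⁻¹ (v ⊗ₜ w)))
    rw [Grading.scale₁_apply _ (hv.tmul hw), map_smul, Grading.scale₂_apply _ hv hw,
      Grading.scale₂_apply _ hv hw, map_smul,
      Grading.scale₂_apply _ (hv.shift h) (hw.shift h), map_smul, map_smul,
      TensorProduct.map_tmul, Grading.scale₁_apply _ hv, Grading.scale₁_apply _ hw,
      TensorProduct.tmul_smul, ← TensorProduct.smul_tmul', smul_smul, smul_smul, smul_smul,
      smul_smul]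
    congr 1
    have := congrArg (fun r : kˣ => ((r⁻¹ : kˣ) : k)) (A.τ_mul g h x y)
    simp only [mul_inv, Units.val_mul] at this
    simp only [Pi.inv_apply]
    linear_combination this

end ActionData
end Action

section Equivariantization

variable {k : Type u} {Γ : Type v} [Field k] [Group Γ] [Fintype Γ] {c : Cocycle3 k Γ}
  {G : Type w} [Group G] [MulDistribMulAction G Γ]

open VecGr

/-- The objects of the equivariantization `C(Γ, ω)^G`: pairs `(X, μ)` with isomorphisms
`μ^g : ρ^g X → X` such that `μ^g ρ^g(μ^h) = μ^{gh} ρ₂^{g,h}` and `μ^e ρ₀ = id`. -/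
structure Equivariant (A : ActionData c G) where
  obj : VecGr c
  μ : ∀ g : G, (A.ρ g).obj obj ⟶ obj
  isIso : ∀ g, IsIso (μ g)
  μ_mul : ∀ g h, (A.ρ g).map (μ h) ≫ μ g = (A.ρ₂ g h obj).hom ≫ μ (g * h)
  μ_one : (A.ρ₀ obj).hom ≫ μ 1 = 𝟙 obj

namespace Equivariant

variable {A : ActionData c G}

/-- Morphisms `f : (X, μ) → (X', μ')` are the `f : X → X'` with `f μ^g = μ'^g ρ^g(f)`. -/
@[ext]
structure Hom (X Y : Equivariant A) where
  hom : X.obj ⟶ Y.obj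
  comm : ∀ g, X.μ g ≫ hom = (A.ρ g).map hom ≫ Y.μ g

instance : Category (Equivariant A) where
  Hom := Hom
  id X := ⟨𝟙 X.obj, fun g => by simp⟩
  comp f g := ⟨f.hom ≫ g.hom, fun a => by
    rw [← Category.assoc, f.comm, Category.assoc, g.comm, Functor.map_comp, Category.assoc]⟩
  id_comp f := Hom.ext (Category.id_comp f.hom)
  comp_id f := Hom.ext (Category.comp_id f.hom)
  assoc f g h := Hom.ext (Category.assoc f.hom g.hom h.hom)

/-- The underlying morphism in `C(Γ, ω)`. -/
def under {X Y : Equivariant A} (f : X ⟶ Y) : X.obj ⟶ Y.obj := Hom.hom f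

theorem under_comm {X Y : Equivariant A} (f : X ⟶ Y) (g : G) :
    X.μ g ≫ under f = (A.ρ g).map (under f) ≫ Y.μ g := Hom.comm f g

theorem hom_ext {X Y : Equivariant A} {f g : X ⟶ Y} (h : under f = under g) : f = g :=
  Hom.ext h

/-- Constructor for morphisms. -/
def mkHom {X Y : Equivariant A} (f : X.obj ⟶ Y.obj)
    (h : ∀ g, X.μ g ≫ f = (A.ρ g).map f ≫ Y.μ g) : X ⟶ Y := ⟨f, h⟩

@[simp] theorem under_id (X : Equivariant A) : under (𝟙 X) = 𝟙 X.obj := rfl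

@[simp] theorem under_comp {X Y Z : Equivariant A} (f : X ⟶ Y) (g : Y ⟶ Z) :
    under (f ≫ g) = under f ≫ under g := rfl

@[simp] theorem under_mkHom {X Y : Equivariant A} (f : X.obj ⟶ Y.obj)
    (h : ∀ g, X.μ g ≫ f = (A.ρ g).map f ≫ Y.μ g) : under (mkHom f h) = f := rfl

/-- An equivariant isomorphism of `C(Γ, ω)` is an isomorphism of `C(Γ, ω)^G`. -/
def mkIso {X Y : Equivariant A} (e : X.obj ≅ Y.obj)
    (h : ∀ g, X.μ g ≫ e.hom = (A.ρ g).map e.hom ≫ Y.μ g) : X ≅ Y where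
  hom := mkHom e.hom h
  inv := mkHom e.inv fun g => by
    have h' := h g
    rw [← cancel_mono e.hom, Category.assoc, e.inv_hom_id, Category.comp_id, Category.assoc, h',
      ← Category.assoc, ← Functor.map_comp, e.inv_hom_id,
      CategoryTheory.Functor.map_id, Category.id_comp]
  hom_inv_id := hom_ext e.hom_inv_id
  inv_hom_id := hom_ext e.inv_hom_id

/-- The equivariant morphisms form a linear subspace of all morphisms. -/
def homSubmodule (X Y : Equivariant A) : Submodule k (X.obj ⟶ Y.obj) where
  carrier := {f | ∀ g, X.μ g ≫ f = (A.ρ g).map f ≫ Y.μ g}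
  zero_mem' g := by
    rw [show (A.ρ g).map (0 : X.obj ⟶ Y.obj) = 0 from rfl]
    simp
  add_mem' {f f'} hf hf' g := by
    rw [show (A.ρ g).map (f + f') = (A.ρ g).map f + (A.ρ g).map f' from rfl, Preadditive.comp_add,
      Preadditive.add_comp, hf g, hf' g]
  smul_mem' r f hf g := by
    rw [show (A.ρ g).map (r • f) = r • (A.ρ g).map f from rfl, Linear.comp_smul, Linear.smul_comp,
      hf g]

/-- Morphisms as elements of the subspace `homSubmodule`. -/
def homEquiv (X Y : Equivariant A) : (X ⟶ Y) ≃ homSubmodule X Y where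
  toFun f := ⟨under f, under_comm f⟩
  invFun f := mkHom f.1 f.2
  left_inv _ := rfl
  right_inv _ := rfl

instance (X Y : Equivariant A) : AddCommGroup (X ⟶ Y) := (homEquiv X Y).addCommGroup

instance (X Y : Equivariant A) : Module k (X ⟶ Y) := (homEquiv X Y).module k

@[simp] theorem under_add {X Y : Equivariant A} (f g : X ⟶ Y) :
    under (f + g) = under f + under g := rfl

@[simp] theorem under_smul {X Y : Equivariant A} (r : k) (f : X ⟶ Y) :
    under (r • f) = r • under f := rfl

instance : Preadditive (Equivariant A) where
  add_comp _ _ _ _ _ _ := hom_ext (by simp)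
  comp_add _ _ _ _ _ _ := hom_ext (by simp)

instance : Linear k (Equivariant A) where
  smul_comp _ _ _ _ _ _ := hom_ext (by simp)
  comp_smul _ _ _ _ _ _ := hom_ext (by simp)

/-- The tensor product `(X, μ) ⊗ (Y, ν) = (X ⊗ Y, (μ^g ⊗ ν^g) (ρ₂^g)_{X,Y})`. -/
def tensor (X Y : Equivariant A) : Equivariant A where
  obj := X.obj ⊗ Y.obj
  μ g := (A.tens g X.obj Y.obj).hom ≫ (X.μ g ⊗ₘ Y.μ g)
  isIso g := by
    have := X.isIso g
    have := Y.isIso g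
    infer_instance
  μ_mul g h := by
    rw [Functor.map_comp, Category.assoc, ← Category.assoc ((A.ρ g).map (X.μ h ⊗ₘ Y.μ h)),
      A.tens_naturality, Category.assoc, tensorHom_comp_tensorHom, X.μ_mul, Y.μ_mul,
      ← tensorHom_comp_tensorHom, ← Category.assoc (A.ρ₂ g h _).hom, A.tens_ρ₂]
    simp only [Category.assoc]
  μ_one := by
    have h : (A.ρ₀ (X.obj ⊗ Y.obj)).hom ≫ (A.tens 1 X.obj Y.obj).hom =
        ((A.ρ₀ X.obj).hom ⊗ₘ (A.ρ₀ Y.obj).hom) := VecGr.hom_ext <|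
      X.obj.gr.ext₂ Y.obj.gr fun x v y w hv hw => by
        change X.obj.gr.scale₂ Y.obj.gr (A.τ 1)⁻¹ (v ⊗ₜ w) = v ⊗ₜ w
        rw [Grading.scale₂_apply _ hv hw]
        simp [A.τ_one]
    rw [← Category.assoc, h, tensorHom_comp_tensorHom, X.μ_one, Y.μ_one]
    simp

/-- The unit object of `C(Γ, ω)^G`. -/
def unit (A : ActionData c G) : Equivariant A where
  obj := 𝟙_ (VecGr c)
  μ g := (A.unitIso g).hom
  isIso g := inferInstance
  μ_mul g h := VecGr.hom_ext <| by
    refine LinearMap.ext fun r => ?_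
    change r = (Grading.unit : Grading k Γ k).scale₁ (A.σ g h)⁻¹ r
    rw [Grading.scale₁_apply _ (Grading.deg_unit (show k from r))]
    rw [Pi.inv_apply, A.σ_one, inv_one, Units.val_one]
    exact (one_smul k (show k from r)).symm
  μ_one := VecGr.hom_ext rfl

theorem leftUnitor_comm (g : G) (X : VecGr c) :
    (A.ρ g).map (λ_ X).hom = (A.tens g (𝟙_ _) X).hom ≫ ((A.unitIso g).hom ⊗ₘ 𝟙 _) ≫
      (λ_ ((A.ρ g).obj X)).hom := VecGr.hom_ext <|
  Grading.ext_unit₁ X.gr fun y w hw => by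
    change TensorProduct.lid k X.carrier ((1 : k) ⊗ₜ w) =
      TensorProduct.lid k X.carrier (TensorProduct.map LinearMap.id LinearMap.id
        ((Grading.unit : Grading k Γ k).scale₂ X.gr (A.τ g)⁻¹ ((1 : k) ⊗ₜ w)))
    rw [Grading.scale₂_apply _ (Grading.deg_unit (1 : k)) hw]
    simp [A.τ_one_left]

theorem rightUnitor_comm (g : G) (X : VecGr c) :
    (A.ρ g).map (ρ_ X).hom = (A.tens g X (𝟙_ _)).hom ≫ (𝟙 _ ⊗ₘ (A.unitIso g).hom) ≫
      (ρ_ ((A.ρ g).obj X)).hom := VecGr.hom_ext <|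
  Grading.ext_unit₂ X.gr fun y w hw => by
    change TensorProduct.rid k X.carrier (w ⊗ₜ (1 : k)) =
      TensorProduct.rid k X.carrier (TensorProduct.map LinearMap.id LinearMap.id
        (X.gr.scale₂ (Grading.unit : Grading k Γ k) (A.τ g)⁻¹ (w ⊗ₜ (1 : k))))
    rw [Grading.scale₂_apply _ hw (Grading.deg_unit (1 : k))]
    simp [A.τ_one_right]

/-- The tensor product of equivariant morphisms. -/
def tensorMap {X X' Y Y' : Equivariant A} (f : X ⟶ X') (f' : Y ⟶ Y') :
    tensor X Y ⟶ tensor X' Y' :=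
  mkHom (under f ⊗ₘ under f') fun g => by
    change ((A.tens g X.obj Y.obj).hom ≫ (X.μ g ⊗ₘ Y.μ g)) ≫ _ =
      (A.ρ g).map (under f ⊗ₘ under f') ≫ ((A.tens g X'.obj Y'.obj).hom ≫ (X'.μ g ⊗ₘ Y'.μ g))
    rw [Category.assoc, tensorHom_comp_tensorHom, under_comm, under_comm,
      ← tensorHom_comp_tensorHom, ← Category.assoc, ← A.tens_naturality, Category.assoc]

theorem associator_equivariant (X Y Z : Equivariant A) (g : G) :
    ((A.tens g (X.obj ⊗ Y.obj) Z.obj).hom ≫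
        (((A.tens g X.obj Y.obj).hom ≫ (X.μ g ⊗ₘ Y.μ g)) ⊗ₘ Z.μ g)) ≫
          (α_ X.obj Y.obj Z.obj).hom =
      (A.ρ g).map (α_ X.obj Y.obj Z.obj).hom ≫ ((A.tens g X.obj (Y.obj ⊗ Z.obj)).hom ≫
        (X.μ g ⊗ₘ ((A.tens g Y.obj Z.obj).hom ≫ (Y.μ g ⊗ₘ Z.μ g)))) := by
  have h₁ : (((A.tens g X.obj Y.obj).hom ≫ (X.μ g ⊗ₘ Y.μ g)) ⊗ₘ Z.μ g) =
      ((A.tens g X.obj Y.obj).hom ⊗ₘ 𝟙 _) ≫ ((X.μ g ⊗ₘ Y.μ g) ⊗ₘ Z.μ g) := by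
    rw [tensorHom_comp_tensorHom, Category.id_comp]
  have h₂ : (X.μ g ⊗ₘ ((A.tens g Y.obj Z.obj).hom ≫ (Y.μ g ⊗ₘ Z.μ g))) =
      (𝟙 _ ⊗ₘ (A.tens g Y.obj Z.obj).hom) ≫ (X.μ g ⊗ₘ (Y.μ g ⊗ₘ Z.μ g)) := by
    rw [tensorHom_comp_tensorHom, Category.id_comp]
  rw [h₁, h₂, Category.assoc, Category.assoc, associator_naturality]
  have h₃ := A.tens_assoc g X.obj Y.obj Z.obj =≫ (X.μ g ⊗ₘ (Y.μ g ⊗ₘ Z.μ g))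
  simp only [Category.assoc] at h₃
  exact h₃.symm

theorem leftUnitor_equivariant (X : Equivariant A) (g : G) :
    ((A.tens g (𝟙_ _) X.obj).hom ≫ ((A.unitIso g).hom ⊗ₘ X.μ g)) ≫ (λ_ X.obj).hom =
      (A.ρ g).map (λ_ X.obj).hom ≫ X.μ g := by
  have h₁ : ((A.unitIso g).hom ⊗ₘ X.μ g) =
      ((A.unitIso g).hom ⊗ₘ 𝟙 _) ≫ (𝟙 _ ⊗ₘ X.μ g) := by
    rw [tensorHom_comp_tensorHom, Category.id_comp, Category.comp_id]
  rw [leftUnitor_comm, h₁]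
  simp only [Category.assoc]
  rw [id_tensorHom, leftUnitor_naturality]

theorem rightUnitor_equivariant (X : Equivariant A) (g : G) :
    ((A.tens g X.obj (𝟙_ _)).hom ≫ (X.μ g ⊗ₘ (A.unitIso g).hom)) ≫ (ρ_ X.obj).hom =
      (A.ρ g).map (ρ_ X.obj).hom ≫ X.μ g := by
  have h₁ : (X.μ g ⊗ₘ (A.unitIso g).hom) =
      (𝟙 _ ⊗ₘ (A.unitIso g).hom) ≫ (X.μ g ⊗ₘ 𝟙 _) := by
    rw [tensorHom_comp_tensorHom, Category.id_comp, Category.comp_id]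
  rw [rightUnitor_comm, h₁]
  simp only [Category.assoc]
  rw [tensorHom_id, rightUnitor_naturality]

instance : MonoidalCategoryStruct (Equivariant A) where
  tensorObj := tensor
  tensorUnit := unit A
  tensorHom := tensorMap
  whiskerLeft X _ _ f := tensorMap (𝟙 X) f
  whiskerRight f Y := tensorMap f (𝟙 Y)
  associator X Y Z := mkIso (X := tensor (tensor X Y) Z) (Y := tensor X (tensor Y Z))
    (α_ X.obj Y.obj Z.obj) fun g => associator_equivariant X Y Z g
  leftUnitor X := mkIso (X := tensor (unit A) X) (λ_ X.obj) fun g => leftUnitor_equivariant X g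
  rightUnitor X := mkIso (X := tensor X (unit A)) (ρ_ X.obj) fun g => rightUnitor_equivariant X g

/-- `C(Γ, ω)^G` is a monoidal category. -/
instance : MonoidalCategory (Equivariant A) := MonoidalCategory.ofTensorHom
  (id_tensorHom_id := fun X Y => hom_ext (id_tensorHom_id X.obj Y.obj))
  (id_tensorHom := fun _ _ _ _ => rfl)
  (tensorHom_id := fun _ _ => rfl)
  (tensorHom_comp_tensorHom := fun f₁ f₂ g₁ g₂ => hom_ext
    (tensorHom_comp_tensorHom (under f₁) (under f₂) (under g₁) (under g₂)))
  (associator_naturality := fun f₁ f₂ f₃ => hom_ext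
    (associator_naturality (under f₁) (under f₂) (under f₃)))
  (leftUnitor_naturality := fun f => hom_ext (leftUnitor_naturality (under f)))
  (rightUnitor_naturality := fun f => hom_ext (rightUnitor_naturality (under f)))
  (pentagon := fun W X Y Z => hom_ext (pentagon W.obj X.obj Y.obj Z.obj))
  (triangle := fun X Y => hom_ext (triangle X.obj Y.obj))

end Equivariant
end Equivariantization

section ProjectiveRepresentations

variable {k : Type u} [Field k] {G : Type w} [Group G]

/-- A projective representation `π` of the subgroup `H ⊆ G` on `V` with factor set (the
restriction to `H` of) `α`: `π(e) = id` and `π(gh) = α(g, h) π(g) π(h)`. The maps `π(g)` are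
automatically invertible, see `ProjRep.bijective`. -/
structure ProjRep (k : Type u) [Field k] {G : Type w} [Group G] (H : Subgroup G)
    (α : G → G → kˣ) (V : Type*) [AddCommGroup V] [Module k V] where
  toFun : H → V →ₗ[k] V
  map_one : toFun 1 = LinearMap.id
  map_mul : ∀ g h : H, toFun (g * h) = (α g h : k) • (toFun g ∘ₗ toFun h)

namespace ProjRep

variable {H K : Subgroup G} {α : G → G → kˣ} {V W : Type*} [AddCommGroup V] [Module k V]
  [AddCommGroup W] [Module k W]

theorem bijective (π : ProjRep k H α V) (g : H) : Function.Bijective (π.toFun g) := by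
  have h₁ := π.map_mul g⁻¹ g
  have h₂ := π.map_mul g g⁻¹
  rw [inv_mul_cancel, π.map_one] at h₁
  rw [mul_inv_cancel, π.map_one] at h₂
  constructor
  · intro v w e
    have e₁ := LinearMap.congr_fun h₁ v
    have e₂ := LinearMap.congr_fun h₁ w
    simp only [LinearMap.id_apply, LinearMap.smul_apply, LinearMap.comp_apply] at e₁ e₂
    rw [e₁, e₂, e]
  · intro v
    refine ⟨(α g (g⁻¹ : H) : k) • π.toFun g⁻¹ v, ?_⟩
    have e₁ := LinearMap.congr_fun h₂ v
    simp only [LinearMap.id_apply, LinearMap.smul_apply, LinearMap.comp_apply] at e₁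
    rw [map_smul]; exact e₁.symm

/-- Irreducibility: `V ≠ 0` and the only invariant subspaces are `0` and `V`. -/
def IsIrreducible (π : ProjRep k H α V) : Prop :=
  Nontrivial V ∧ ∀ U : Submodule k V, (∀ g, ∀ v ∈ U, π.toFun g v ∈ U) → U = ⊥ ∨ U = ⊤

/-- Restriction to a subgroup. -/
def restrict (π : ProjRep k H α V) (h : K ≤ H) : ProjRep k K α V where
  toFun g := π.toFun ⟨g, h g.2⟩
  map_one := π.map_one
  map_mul g g' := π.map_mul ⟨g, h g.2⟩ ⟨g', h g'.2⟩

/-- The space `Hom_{k_α H}(V, W)` of intertwiners of two projective representations with the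
same factor set. -/
def intertwiners (π' : ProjRep k H α V) (π : ProjRep k H α W) : Submodule k (V →ₗ[k] W) where
  carrier := {f | ∀ g, f ∘ₗ π'.toFun g = π.toFun g ∘ₗ f}
  zero_mem' g := by simp
  add_mem' hf hf' g := by rw [LinearMap.add_comp, LinearMap.comp_add, hf g, hf' g]
  smul_mem' r f hf g := by rw [LinearMap.smul_comp, LinearMap.comp_smul, hf g]

/-- The multiplicity (intertwining number) `m_H(π', π) = dim Hom_{k_α H}(V_{π'}, V_π)`. -/
def multiplicity (π' : ProjRep k H α V) (π : ProjRep k H α W) : ℕ :=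
  Module.finrank k (intertwiners π' π)

end ProjRep
end ProjectiveRepresentations

section SimpleObjects

theorem units_identity₁ {k : Type*} [Field k] {S₁ S₂ S₃ X Sa Da Sb Db M N : kˣ}
    (e₁ : S₃ * S₁ = M * Sa) (e₂ : Sb * N = M * Da) (e₃ : Db * N = S₂ * X) :
    S₁ / S₂ * S₃ = X * (Sa / Da) * (Sb / Db) := by
  have h₁ := congrArg (fun r : kˣ => (r : k)) e₁
  have h₂ := congrArg (fun r : kˣ => (r : k)) e₂
  have h₃ := congrArg (fun r : kˣ => (r : k)) e₃
  simp only [Units.val_mul] at h₁ h₂ h₃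
  apply Units.ext
  simp only [Units.val_mul, Units.val_div_eq_div_val]
  have := S₂.ne_zero
  have := Da.ne_zero
  have := Db.ne_zero
  field_simp
  linear_combination (Da * Db : k) * h₁ - (Db * Sa : k) * h₂ + (Sb * Sa : k) * h₃

theorem units_identity₂ {k : Type*} [Field k] {t t₁ t₂ s s₁ s₂ : kˣ}
    (e : t * s = (s₁ * s₂) * (t₁ * t₂)) : t⁻¹ * (s₁ * s₂) = s * (t₁⁻¹ * t₂⁻¹) := by
  rw [inv_mul_eq_iff_eq_mul, ← mul_inv, ← mul_assoc, e, mul_inv_cancel_right]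

theorem units_identity₃ {k : Type*} [Field k] {P D₁ Q D₂ S R D X M N : kˣ}
    (e₁ : S * R = M * P) (e₂ : D₂ * N = D * X) (e₃ : Q * N = M * D₁) :
    P / D₁ * (Q / D₂) = X⁻¹ * (R / D) * S := by
  have h₁ := congrArg (fun r : kˣ => (r : k)) e₁
  have h₂ := congrArg (fun r : kˣ => (r : k)) e₂
  have h₃ := congrArg (fun r : kˣ => (r : k)) e₃
  simp only [Units.val_mul] at h₁ h₂ h₃
  apply Units.ext
  simp only [Units.val_mul, Units.val_div_eq_div_val, Units.val_inv_eq_inv_val]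
  have := D₁.ne_zero
  have := D₂.ne_zero
  have := D.ne_zero
  have := X.ne_zero
  field_simp
  linear_combination (-(D₁ * D₂) : k) * h₁ + (D₂ * P : k) * h₃ - (P * Q : k) * h₂

variable {k : Type u} {Γ : Type v} [Field k] [Group Γ] [Fintype Γ] {c : Cocycle3 k Γ}

section Reps

variable {G : Type w} [Group G] [MulDistribMulAction G Γ]

/-- The factor set `σ_x(g, h) = σ(g, h; x)`. -/
def ActionData.factorSet (A : ActionData c G) (x : Γ) : G → G → kˣ := fun g h => A.σ g h x

open MulAction

theorem conj_mem {y : Γ} (t : G) (g : stabilizer G (t • y)) :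
    t⁻¹ * (g : G) * t ∈ stabilizer G y := by
  have := mem_stabilizer_iff.1 g.2
  rw [mem_stabilizer_iff, mul_smul, mul_smul, this, inv_smul_smul]

/-- The conjugate `ᵗπ` of a projective representation `π` of `G_y` with factor set `σ_y`, as a
projective representation of `ᵗG_y = t G_y t⁻¹ = G_{ᵗy}` with factor set `σ_{ᵗy}`:
`ᵗπ(g) = (σ(t, t⁻¹gt; y) / σ(g, t; y)) π(t⁻¹gt)`.
The scalar is the one by which the isomorphism
`ρ^g ρ^t y → ρ^{gt} y = ρ^t ρ^{t⁻¹gt} y → ρ^t y` obtained from `ρ₂` differs from the identity;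
the bare map `g ↦ π(t⁻¹gt)` is a projective representation with respect to a factor set which
is only cohomologous to `σ_{ᵗy}`. -/
def ProjRep.conj (A : ActionData c G) {y : Γ} {V : Type*} [AddCommGroup V] [Module k V]
    (π : ProjRep k (stabilizer G y) (A.factorSet y) V) (t : G) :
    ProjRep k (stabilizer G (t • y)) (A.factorSet (t • y)) V where
  toFun g := ((A.σ t (t⁻¹ * g * t) y / A.σ g t y : kˣ) : k) •
    π.toFun ⟨t⁻¹ * g * t, conj_mem t g⟩
  map_one := by
    have h : (⟨t⁻¹ * ((1 : stabilizer G (t • y)) : G) * t, conj_mem t 1⟩ : stabilizer G y) = 1 :=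
      Subtype.ext (by simp)
    rw [h, π.map_one]
    simp [A.σ_one_left, A.σ_one_right]
  map_mul g g' := by
    obtain ⟨a, ha⟩ := g
    obtain ⟨b, hb⟩ := g'
    have hm : (⟨t⁻¹ * (a * b) * t, conj_mem t (⟨a, ha⟩ * ⟨b, hb⟩)⟩ : stabilizer G y) =
        ⟨t⁻¹ * a * t, conj_mem t ⟨a, ha⟩⟩ * ⟨t⁻¹ * b * t, conj_mem t ⟨b, hb⟩⟩ :=
      Subtype.ext (by simp [mul_assoc])
    change _ • π.toFun ⟨t⁻¹ * (a * b) * t, _⟩ = _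
    rw [hm, π.map_mul, smul_smul, LinearMap.smul_comp, LinearMap.comp_smul, smul_smul, smul_smul,
      ← Units.val_mul, ← Units.val_mul, ← Units.val_mul]
    congr 2
    change A.σ t (t⁻¹ * (a * b) * t) y / A.σ (a * b) t y * A.σ (t⁻¹ * a * t) (t⁻¹ * b * t) y =
      A.σ a b (t • y) * (A.σ t (t⁻¹ * a * t) y / A.σ a t y) * (A.σ t (t⁻¹ * b * t) y / A.σ b t y)
    have hy : (t⁻¹ * b * t) • y = y := mem_stabilizer_iff.1 (conj_mem t ⟨b, hb⟩)
    have e₁ := A.σ_mul t (t⁻¹ * a * t) (t⁻¹ * b * t) y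
    have e₂ := A.σ_mul a t (t⁻¹ * b * t) y
    have e₃ := A.σ_mul a b t y
    rw [hy] at e₁ e₂
    rw [show t⁻¹ * a * t * (t⁻¹ * b * t) = t⁻¹ * (a * b) * t by group,
      show t * (t⁻¹ * a * t) = a * t by group] at e₁
    rw [show t * (t⁻¹ * b * t) = b * t by group] at e₂
    exact units_identity₁ e₁ e₂ e₃

/-- For `x = ab`, the tensor product `(π ⊗ γ) τ_{a,b}⁻¹`, as a projective representation of
`G_a ∩ G_b` with factor set `σ_x`. -/
def ProjRep.tensorTwist (A : ActionData c G) {x a b : Γ} (hx : x = a * b)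
    {V W : Type*} [AddCommGroup V] [Module k V] [AddCommGroup W] [Module k W]
    (π : ProjRep k (stabilizer G a) (A.factorSet a) V)
    (γ : ProjRep k (stabilizer G b) (A.factorSet b) W) :
    ProjRep k (stabilizer G a ⊓ stabilizer G b : Subgroup G) (A.factorSet x) (V ⊗[k] W) where
  toFun g := (((A.τ g a b)⁻¹ : kˣ) : k) •
    TensorProduct.map (π.toFun ⟨g, g.2.1⟩) (γ.toFun ⟨g, g.2.2⟩)
  map_one := by
    have h₁ := π.map_one
    have h₂ := γ.map_one
    change (((A.τ 1 a b)⁻¹ : kˣ) : k) • TensorProduct.map (π.toFun 1) (γ.toFun 1) = _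
    rw [h₁, h₂, A.τ_one, TensorProduct.map_id]
    simp
  map_mul g g' := by
    obtain ⟨g, hg⟩ := g
    obtain ⟨h, hh⟩ := g'
    change (((A.τ (g * h) a b)⁻¹ : kˣ) : k) •
      TensorProduct.map (π.toFun (⟨g, hg.1⟩ * ⟨h, hh.1⟩)) (γ.toFun (⟨g, hg.2⟩ * ⟨h, hh.2⟩)) = _
    rw [π.map_mul, γ.map_mul, TensorProduct.map_smul_left, TensorProduct.map_smul_right,
      LinearMap.smul_comp, LinearMap.comp_smul, ← TensorProduct.map_comp]
    simp only [smul_smul, ← Units.val_mul]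
    congr 2
    have e := A.τ_mul g h a b
    have h₁ : h • a = a := mem_stabilizer_iff.1 hh.1
    have h₂ : h • b = b := mem_stabilizer_iff.1 hh.2
    rw [h₁, h₂] at e
    subst hx
    exact units_identity₂ e

theorem inertia_inf_le {x a b : Γ} (hx : x = a * b) :
    stabilizer G a ⊓ stabilizer G b ≤ stabilizer G x := by
  intro g hg
  have h₁ := mem_stabilizer_iff.1 hg.1
  have h₂ := mem_stabilizer_iff.1 hg.2
  rw [mem_stabilizer_iff, hx, smul_mul', h₁, h₂]

end Reps

section Induction

open MulAction

variable {G : Type u} [Group G] [MulDistribMulAction G Γ] (A : ActionData c G) (y : Γ)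
  {V : Type u} [AddCommGroup V] [Module k V]

/-- The chosen representative `t` of a left coset `q ∈ G / G_y`. -/
def rep (q : G ⧸ stabilizer G y) : G := q.out

theorem rep_mk (q : G ⧸ stabilizer G y) : QuotientGroup.mk (rep y q) = q :=
  QuotientGroup.out_eq' q

/-- For representatives `t` of `q` and `s` of `gq`, the element `h ∈ G_y` with `gt = sh`. -/
def transition (g : G) (q : G ⧸ stabilizer G y) : stabilizer G y :=
  ⟨(rep y (g • q))⁻¹ * (g * rep y q), by
    refine QuotientGroup.eq.1 ?_
    rw [rep_mk]
    conv_lhs => rw [← rep_mk y q]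
    rfl⟩

variable (k V) in
/-- The grading of `⨁_{t ∈ G/G_y} ρ^t(V ⊗ y)`: the summand with index `t` has degree `ᵗy`. -/
def inducedGrading : Grading k Γ ((G ⧸ stabilizer G y) → V) where
  proj x := by
    classical exact LinearMap.pi fun q => if rep y q • y = x then LinearMap.proj q else 0
  proj_self x f := by
    funext q
    by_cases h : rep y q • y = x <;> simp [h]
  proj_ne x x' hx f := by
    funext q
    by_cases h : rep y q • y = x
    · have : rep y q • y ≠ x' := fun e => hx (h.symm.trans e)
      simp [h, hx]
    · simp [h]
  sum_proj f := by
    classical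
    funext q
    rw [Finset.sum_apply, Finset.sum_eq_single (rep y q • y)] <;> simp +contextual [eq_comm]

/-- The equivariant structure of `⨁_{t ∈ G/G_y} ρ^t(V ⊗ y)`, where `V ⊗ y` carries the
`G_y`-equivariant structure `π(h) ⊗ id`: on the summand of `t`, with `gt = sh`,
`μ^g = ρ^s(π(h) ⊗ id) (ρ₂^{s,h})⁻¹ ρ₂^{g,t}`, which is `(σ(s, h; y) / σ(g, t; y)) π(h)`, with
values in the summand of `s`. -/
def inducedAct (π : ProjRep k (stabilizer G y) (A.factorSet y) V) (g : G) :
    ((G ⧸ stabilizer G y) → V) →ₗ[k] ((G ⧸ stabilizer G y) → V) :=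
  LinearMap.pi fun q =>
    ((A.σ (rep y (g • g⁻¹ • q)) (transition y g (g⁻¹ • q)) y / A.σ g (rep y (g⁻¹ • q)) y : kˣ) : k) •
      (π.toFun (transition y g (g⁻¹ • q)) ∘ₗ LinearMap.proj (g⁻¹ • q))


variable {A y}

theorem inducedAct_apply (π : ProjRep k (stabilizer G y) (A.factorSet y) V) (g : G)
    (f : (G ⧸ stabilizer G y) → V) (q : G ⧸ stabilizer G y) :
    inducedAct A y π g f (g • q) =
      ((A.σ (rep y (g • q)) (transition y g q) y / A.σ g (rep y q) y : kˣ) : k) •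
        π.toFun (transition y g q) (f q) := by
  simp only [inducedAct, LinearMap.pi_apply, LinearMap.smul_apply, LinearMap.comp_apply,
    LinearMap.proj_apply, inv_smul_smul]

theorem rep_mul_transition (g : G) (q : G ⧸ stabilizer G y) :
    rep y (g • q) * (transition y g q : G) = g * rep y q :=
  mul_inv_cancel_left _ _

theorem deg_induced {x : Γ} {f : (G ⧸ stabilizer G y) → V} :
    (inducedGrading k y V).Deg x f ↔ ∀ q, rep y q • y ≠ x → f q = 0 := by
  unfold Grading.Deg
  rw [funext_iff]
  refine forall_congr' fun q => ?_
  by_cases h : rep y q • y = x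
  · simp [inducedGrading, h]
  · simp [inducedGrading, h, eq_comm]

theorem scale₁_induced [Finite G] (φ : Γ → kˣ) (f : (G ⧸ stabilizer G y) → V)
    (q : G ⧸ stabilizer G y) :
    (inducedGrading k y V).scale₁ φ f q = (φ (rep y q • y) : k) • f q := by
  classical
  rw [Grading.scale₁, LinearMap.sum_apply, Finset.sum_apply,
    Finset.sum_eq_single (rep y q • y)]
  · simp [inducedGrading]
  · intro x _ hx
    simp [inducedGrading, hx.symm]
  · simp

theorem inducedAct_deg (π : ProjRep k (stabilizer G y) (A.factorSet y) V) (g : G) (x : Γ)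
    (f : (G ⧸ stabilizer G y) → V) (hf : ((inducedGrading k y V).shift g).Deg x f) :
    (inducedGrading k y V).Deg x (inducedAct A y π g f) := by
  rw [Grading.deg_shift, deg_induced] at hf
  rw [deg_induced]
  intro q' hq'
  obtain ⟨q, rfl⟩ : ∃ q, g • q = q' := ⟨g⁻¹ • q', smul_inv_smul _ _⟩
  rw [inducedAct_apply, hf q, map_zero, smul_zero]
  intro e
  apply hq'
  have h : (transition y g q : G) • y = y := mem_stabilizer_iff.1 (transition y g q).2
  have h' : (rep y (g • q) * (transition y g q : G)) • y = x := by
    rw [rep_mul_transition, mul_smul, e, smul_inv_smul]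
  rwa [mul_smul, h] at h'

theorem inducedAct_mul [Finite G] (π : ProjRep k (stabilizer G y) (A.factorSet y) V) (g h : G)
    (f : (G ⧸ stabilizer G y) → V) :
    inducedAct A y π g (inducedAct A y π h f) =
      inducedAct A y π (g * h) ((inducedGrading k y V).scale₁ (A.σ g h)⁻¹ f) := by
  funext q'
  obtain ⟨q, rfl⟩ : ∃ q, (g * h) • q = q' := ⟨(g * h)⁻¹ • q', smul_inv_smul _ _⟩
  have ht : transition y (g * h) q = transition y g (h • q) * transition y h q := by
    apply Subtype.ext
    apply mul_left_cancel (a := rep y ((g * h) • q))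
    rw [rep_mul_transition, Subgroup.coe_mul, ← mul_assoc, mul_smul, rep_mul_transition,
      mul_assoc, mul_assoc, rep_mul_transition]
  rw [inducedAct_apply, scale₁_induced, ht, π.map_mul, mul_smul, inducedAct_apply,
    inducedAct_apply, map_smul, map_smul]
  simp only [LinearMap.smul_apply, LinearMap.comp_apply, smul_smul, ← Units.val_mul]
  congr 2
  have hy : (transition y h q : G) • y = y := mem_stabilizer_iff.1 (transition y h q).2
  have e₁ := A.σ_mul (rep y (g • h • q)) (transition y g (h • q)) (transition y h q) y
  have e₂ := A.σ_mul g h (rep y q) y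
  have e₃ := A.σ_mul g (rep y (h • q)) (transition y h q) y
  rw [hy, rep_mul_transition] at e₁
  rw [hy, rep_mul_transition] at e₃
  have e := units_identity₃ e₁ e₂ e₃
  rw [← mul_smul] at e
  rw [e, mul_assoc, mul_left_comm]
  rfl

theorem inducedAct_one (π : ProjRep k (stabilizer G y) (A.factorSet y) V)
    (f : (G ⧸ stabilizer G y) → V) : inducedAct A y π 1 f = f := by
  funext q'
  obtain ⟨q, rfl⟩ : ∃ q, (1 : G) • q = q' := ⟨q', one_smul _ _⟩
  have ht : transition y 1 q = 1 := by
    apply Subtype.ext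
    apply mul_left_cancel (a := rep y ((1 : G) • q))
    rw [rep_mul_transition, one_smul]
    simp
  rw [inducedAct_apply, ht, π.map_one, one_smul]
  simp [A.σ_one_left, A.σ_one_right]

theorem inducedAct_bijective [Finite G] (π : ProjRep k (stabilizer G y) (A.factorSet y) V)
    (g : G) : Function.Bijective (inducedAct A y π g) := by
  have hs : ∀ φ : Γ → kˣ, Function.Bijective ((inducedGrading (G := G) k y V).scale₁ φ) := fun φ =>
    Function.bijective_iff_has_inverse.2 ⟨(inducedGrading (G := G) k y V).scale₁ φ⁻¹,
      LinearMap.congr_fun ((inducedGrading (G := G) k y V).scale₁_inv φ).2,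
      LinearMap.congr_fun ((inducedGrading (G := G) k y V).scale₁_inv φ).1⟩
  have hb : ∀ a b : G, a * b = 1 →
      Function.Bijective (inducedAct A y π a ∘ inducedAct A y π b) := fun a b hab => by
    have : (inducedAct A y π a ∘ inducedAct A y π b : _ → _) =
        (inducedGrading k y V).scale₁ (A.σ a b)⁻¹ := by
      funext f
      rw [Function.comp_apply, inducedAct_mul, hab, inducedAct_one]
    rw [this]; exact hs _
  exact ⟨(hb g⁻¹ g (inv_mul_cancel g)).injective.of_comp,
    (hb g g⁻¹ (mul_inv_cancel g)).surjective.of_comp⟩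

/-- The simple object `S_{y,π} = L_y(V_π ⊗ y) = ⨁_{t ∈ G/G_y} ρ^t(V_π ⊗ y)` of `C(Γ, ω)^G`. -/
def simpleObj [Finite G] [FiniteDimensional k V] (A : ActionData c G) (y : Γ)
    (π : ProjRep k (stabilizer G y) (A.factorSet y) V) : Equivariant A where
  obj := VecGr.of c ((G ⧸ stabilizer G y) → V) (inducedGrading k y V)
  μ g := VecGr.mkHom
    (V := VecGr.of c ((G ⧸ stabilizer G y) → V) ((inducedGrading k y V).shift g))
    (inducedAct A y π g) (inducedAct_deg π g)
  isIso g := VecGr.isIso_of_bijective _ (inducedAct_bijective π g)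
  μ_mul g h := VecGr.hom_ext (LinearMap.ext fun f => inducedAct_mul π g h f)
  μ_one := VecGr.hom_ext (LinearMap.ext fun f => inducedAct_one π f)

end Induction
end SimpleObjects

section FusionRules

variable {k : Type u} {Γ : Type v} [Field k] [Group Γ] [Fintype Γ] {c : Cocycle3 k Γ}
  {G : Type w} [Group G] [MulDistribMulAction G Γ]

open MulAction

variable (G) in
/-- The pairs `(t, s)` with `x = ᵗy ˢz`. -/
abbrev AdmissiblePair (x y z : Γ) : Type w := {p : G × G // x = (p.1 • y) * (p.2 • z)}

/-- `R` is a system of representatives of the orbits of `G_x` (acting diagonally by left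
multiplication) on the set of the `(t G_y, s G_z) ∈ G/G_y × G/G_z` with `x = ᵗy ˢz`. -/
def IsOrbitTransversal {x y z : Γ} (R : Finset (AdmissiblePair G x y z)) : Prop :=
  ∀ p : AdmissiblePair G x y z, ∃! r, r ∈ R ∧ ∃ g ∈ stabilizer G x,
    (QuotientGroup.mk (g * p.1.1) : G ⧸ stabilizer G y) = QuotientGroup.mk r.1.1 ∧
    (QuotientGroup.mk (g * p.1.2) : G ⧸ stabilizer G z) = QuotientGroup.mk r.1.2

variable (A : ActionData c G) {x y z : Γ} {V₁ V₂ V₃ : Type*}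
  [AddCommGroup V₁] [Module k V₁] [AddCommGroup V₂] [Module k V₂] [AddCommGroup V₃] [Module k V₃]

/-- The multiplicity over `T = ᵗG_y ∩ ˢG_z` of `δ|_T` in `ᵗπ|_T ⊗ ˢγ|_T τ_{ᵗy, ˢz}⁻¹`. -/
def fusionTerm (δ : ProjRep k (stabilizer G x) (A.factorSet x) V₁)
    (π : ProjRep k (stabilizer G y) (A.factorSet y) V₂)
    (γ : ProjRep k (stabilizer G z) (A.factorSet z) V₃) (r : AdmissiblePair G x y z) : ℕ :=
  ProjRep.multiplicity (δ.restrict (inertia_inf_le r.2))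
    (ProjRep.tensorTwist A r.2 (π.conj A r.1.1) (γ.conj A r.1.2))

open Classical in
/-- The sum over the double cosets `D ∈ G_y \ G / G_z` and the representatives `(t, s) ∈ R` with
`t⁻¹s ∈ D` of the multiplicities `fusionTerm`. -/
def fusionSum (δ : ProjRep k (stabilizer G x) (A.factorSet x) V₁)
    (π : ProjRep k (stabilizer G y) (A.factorSet y) V₂)
    (γ : ProjRep k (stabilizer G z) (A.factorSet z) V₃)
    (R : Finset (AdmissiblePair G x y z)) : ℕ :=
  ∑ᶠ D : DoubleCoset.Quotient (stabilizer G y : Set G) (stabilizer G z : Set G),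
    ∑ r ∈ R with DoubleCoset.mk (stabilizer G y) (stabilizer G z) (r.1.1⁻¹ * r.1.2) = D,
      fusionTerm A δ π γ r

end FusionRules

end PointedFusion

end

/-! The proof is Frobenius reciprocity followed by a Mackey-type decomposition. A morphism from the
induced object `S_{x,δ}` to an equivariant object `M` is the same thing as a `G_x`-equivariant
linear map from `V_δ` to the degree `x` component `M_x` (`frobeniusEquiv`): the summand of `t` is
the image under `μ^t` of the summand of the identity coset, so the restriction to that summand
determines the morphism and can be prescribed freely.

For `M = S_{y,π} ⊗ S_{z,γ}` the underlying space is a direct sum of copies of `V_π ⊗ V_γ` indexed by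
the pairs of cosets `(tG_y, sG_z)`, the copy at such a pair having degree `ᵗy ˢz`. Hence `M_x` is
the sum of the copies with `x = ᵗy ˢz`, and `G_x` permutes them. The stabilizer of a pair is `T =
ᵗG_y ∩ ˢG_z`, which lies in `G_x` and acts on its copy by `ᵗπ ⊗ ˢγ τ⁻¹`
(`tensorAct_tensorIncl_twist`). So `M_x` is a sum, over the orbits of pairs, of modules induced from
`T` to `G_x`, and an equivariant map into it amounts to one `T`-intertwiner for each orbit
representative. `pairComponents_injective` holds because a component anywhere in an orbit is carried
by `μ^g` to the representative. `pairComponents_surjective` holds because intertwiners given at the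
representatives can be spread over their orbits by summing translates over `G_x`; each value is then
counted `|T|` times, and dividing by `|T|` uses characteristic zero. Taking dimensions gives
`finrank_hom_tensor`. The sum over double cosets in the formula only groups the elements of `R` by
the class of `t⁻¹s` (`fusionSum_eq_sum`), and a linear monoidal equivalence preserves the dimension
of the morphism space.

The scalars are kept under control by parametrizing the summands of an induced object by all `t ∈ G`
instead of by the chosen coset representatives. With the normalization of `summandIncl` the
inclusion at `t` is `μ^t` applied to the inclusion at `1`, and the cocycle conditions on `σ` enter
through two rules only: `summandIncl_mul` for changing `t` within its coset, and
`inducedAct_summandIncl` for the action. -/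

noncomputable section

set_option linter.unusedSectionVars false

namespace PointedFusion

open MulAction

/-! ### Summands of an induced object, indexed by arbitrary group elements -/

section Summands

variable {k : Type u} {Γ : Type v} [Field k] [Group Γ] [Fintype Γ] {c : Cocycle3 k Γ}
  {G : Type u} [Group G] [MulDistribMulAction G Γ] {A : ActionData c G} {y : Γ}
  {V : Type u} [AddCommGroup V] [Module k V]

/-- The element `h ∈ G_y` with `t = sh`, where `s` is the chosen representative of `t G_y`. -/
def offset (y : Γ) (t : G) : stabilizer G y :=
  ⟨(rep y (QuotientGroup.mk t))⁻¹ * t, QuotientGroup.eq.1 (rep_mk y _)⟩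

theorem rep_mul_offset (y : Γ) (t : G) :
    rep y (QuotientGroup.mk t) * (offset y t : G) = t :=
  mul_inv_cancel_left _ _

theorem rep_smul (y : Γ) (t : G) : rep y (QuotientGroup.mk t) • y = t • y := by
  have h : (offset y t : G) • y = y := mem_stabilizer_iff.1 (offset y t).2
  conv_rhs => rw [← rep_mul_offset y t, mul_smul, h]

theorem offset_mul (y : Γ) (t : G) (h : stabilizer G y) :
    offset y (t * (h : G)) = offset y t * h := by
  apply Subtype.ext
  change (rep y (QuotientGroup.mk (t * (h : G))))⁻¹ * (t * (h : G)) =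
    (rep y (QuotientGroup.mk t))⁻¹ * t * (h : G)
  rw [QuotientGroup.mk_mul_of_mem t h.2, mul_assoc]

theorem offset_rep (y : Γ) (q : G ⧸ stabilizer G y) : offset y (rep y q) = 1 := by
  apply Subtype.ext
  change (rep y (QuotientGroup.mk (rep y q)))⁻¹ * rep y q = 1
  rw [rep_mk, inv_mul_cancel]

/-- The identification of `V` with the summand of the coset of `t`, as a map to the summand of
the chosen representative. -/
def summandEquiv (π : ProjRep k (stabilizer G y) (A.factorSet y) V) (t : G) : V ≃ₗ[k] V :=
  (LinearEquiv.ofBijective (π.toFun (offset y t)) (π.bijective _)).trans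
    (LinearEquiv.smulOfUnit (A.σ (rep y (QuotientGroup.mk t)) (offset y t) y))

theorem summandEquiv_apply (π : ProjRep k (stabilizer G y) (A.factorSet y) V) (t : G) (v : V) :
    summandEquiv π t v =
      (A.σ (rep y (QuotientGroup.mk t)) (offset y t) y : k) • π.toFun (offset y t) v := rfl

open Classical in
/-- The inclusion of `ρ^t(V ⊗ y)` into `S_{y,π}`, for an arbitrary `t ∈ G`. -/
def summandIncl (π : ProjRep k (stabilizer G y) (A.factorSet y) V) (t : G) :
    V →ₗ[k] ((G ⧸ stabilizer G y) → V) :=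
  LinearMap.single k (fun _ => V) (QuotientGroup.mk t) ∘ₗ (summandEquiv π t).toLinearMap

/-- The projection of `S_{y,π}` to `ρ^t(V ⊗ y)`, for an arbitrary `t ∈ G`. -/
def summandProj (π : ProjRep k (stabilizer G y) (A.factorSet y) V) (t : G) :
    ((G ⧸ stabilizer G y) → V) →ₗ[k] V :=
  (summandEquiv π t).symm.toLinearMap ∘ₗ LinearMap.proj (QuotientGroup.mk t)

variable (π : ProjRep k (stabilizer G y) (A.factorSet y) V)

open Classical in
theorem summandIncl_apply (t : G) (v : V) :
    summandIncl π t v = Pi.single (QuotientGroup.mk t) (summandEquiv π t v) := rfl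

open Classical in
theorem summandIncl_rep (q : G ⧸ stabilizer G y) (v : V) :
    summandIncl π (rep y q) v = Pi.single q v := by
  rw [summandIncl_apply, summandEquiv_apply, offset_rep, π.map_one, rep_mk, Subgroup.coe_one,
    A.σ_one_right, Units.val_one, one_smul, LinearMap.id_apply]

theorem summandProj_summandIncl (t : G) (v : V) : summandProj π t (summandIncl π t v) = v := by
  simp [summandProj, summandIncl_apply]

theorem summandProj_summandIncl_of_ne {t a : G}
    (h : (QuotientGroup.mk a : G ⧸ stabilizer G y) ≠ QuotientGroup.mk t) (v : V) :
    summandProj π t (summandIncl π a v) = 0 := by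
  simp [summandProj, summandIncl_apply, h.symm]

/-- The cocycle identity for the chosen representative of `tG_y`, the offset of `t` and `h` turns
the factor set of `π` into the scalar `σ(t, h; y)`; the chosen representative drops out. This is the
rule for changing the representative of a coset. -/
theorem summandIncl_mul (t : G) (h : stabilizer G y) (v : V) :
    summandIncl π (t * (h : G)) v = (A.σ t h y : k) • summandIncl π t (π.toFun h v) := by
  classical
  rw [summandIncl_apply, summandIncl_apply, summandEquiv_apply, summandEquiv_apply, offset_mul,
    π.map_mul, QuotientGroup.mk_mul_of_mem t h.2, ← Pi.single_smul]
  congr 1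
  simp only [LinearMap.smul_apply, LinearMap.comp_apply, smul_smul, ← Units.val_mul]
  congr 2
  have e := A.σ_mul (rep y (QuotientGroup.mk t)) (offset y t) h y
  rw [rep_mul_offset, mem_stabilizer_iff.1 h.2] at e
  rw [← e, mul_comm]
  rfl

/-- The inclusions at the chosen representatives already span. The test is phrased over all `t`
because the formulas for the action hold for all `t`. -/
theorem ext_summandIncl [Finite G] {M : Type*} [AddCommMonoid M] [Module k M]
    {f g : ((G ⧸ stabilizer G y) → V) →ₗ[k] M}
    (h : ∀ t v, f (summandIncl π t v) = g (summandIncl π t v)) : f = g := by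
  classical
  refine LinearMap.pi_ext fun q v => ?_
  rw [← summandIncl_rep π]
  exact h _ v

/-- Write `a = t(t⁻¹a)` with `t⁻¹a ∈ G_y`: the change of representative is absorbed into the vector.
-/
theorem exists_summandIncl_eq {t a : G}
    (h : (QuotientGroup.mk a : G ⧸ stabilizer G y) = QuotientGroup.mk t) (v : V) :
    ∃ w, summandIncl π a v = summandIncl π t w := by
  refine ⟨(A.σ t (t⁻¹ * a) y : k) • π.toFun ⟨t⁻¹ * a, QuotientGroup.eq.1 h.symm⟩ v, ?_⟩
  have e := summandIncl_mul π t ⟨t⁻¹ * a, QuotientGroup.eq.1 h.symm⟩ v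
  rw [mul_inv_cancel_left] at e
  rw [map_smul, e]

theorem deg_summandIncl (t : G) (v : V) :
    (inducedGrading k y V).Deg (t • y) (summandIncl π t v) := by
  classical
  rw [deg_induced]
  intro q hq
  rw [summandIncl_apply, Pi.single_eq_of_ne]
  rintro rfl
  exact hq (rep_smul y t)

theorem inducedAct_single [DecidableEq (G ⧸ stabilizer G y)] (g : G) (q : G ⧸ stabilizer G y)
    (v : V) : inducedAct A y π g (Pi.single q v) = Pi.single (g • q)
      (((A.σ (rep y (g • q)) (transition y g q) y / A.σ g (rep y q) y : kˣ) : k) •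
        π.toFun (transition y g q) v) := by
  funext p
  obtain ⟨p, rfl⟩ : ∃ p', g • p' = p := ⟨g⁻¹ • p, smul_inv_smul _ _⟩
  rw [inducedAct_apply]
  by_cases h : p = q
  · subst h; simp
  · rw [Pi.single_eq_of_ne h, Pi.single_eq_of_ne fun e => h (smul_left_cancel g e), map_zero,
      smul_zero]

/-- This is the representative-free form of the equivariant structure: `μ^g` moves the summand of
`t` to that of `gt`, and the only scalar left comes from `ρ₂^{g,t}`. -/
theorem inducedAct_summandIncl (g t : G) (v : V) :
    inducedAct A y π g (summandIncl π t v) =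
      (((A.σ g t y)⁻¹ : kˣ) : k) • summandIncl π (g * t) v := by
  classical
  -- For a chosen representative `t` with `gt = sh`, the numerator `σ(s, h; y)` in the definition of
  -- the action is the scalar that `summandIncl_mul` produces for `sh`. A general `t` is then
  -- reduced to this case by its offset.
  have hrep : ∀ (q : G ⧸ stabilizer G y) (w : V), inducedAct A y π g (summandIncl π (rep y q) w) =
      (((A.σ g (rep y q) y)⁻¹ : kˣ) : k) • summandIncl π (g * rep y q) w := fun q w => by
    rw [summandIncl_rep, inducedAct_single, ← rep_mul_transition g q, summandIncl_mul,
      summandIncl_rep, smul_smul, ← Pi.single_smul, ← Units.val_mul, div_eq_inv_mul]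
  have e := A.σ_mul g (rep y (QuotientGroup.mk t)) (offset y t) y
  rw [mem_stabilizer_iff.1 (offset y t).2, rep_mul_offset] at e
  conv_lhs => rw [← rep_mul_offset y t]
  conv_rhs => rw [← rep_mul_offset y t, ← mul_assoc, summandIncl_mul]
  rw [summandIncl_mul, map_smul, hrep, smul_smul, smul_smul, ← Units.val_mul, ← Units.val_mul]
  congr 2
  rw [rep_mul_offset, ← div_eq_mul_inv, div_eq_iff_eq_mul, mul_assoc, ← e, mul_left_comm,
    inv_mul_cancel, mul_one]

theorem summandIncl_one_apply (h : stabilizer G y) (v : V) :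
    summandIncl π 1 (π.toFun h v) = summandIncl π (h : G) v := by
  have e := summandIncl_mul π 1 h v
  rw [A.σ_one_left, Units.val_one, one_smul, one_mul] at e
  exact e.symm

/-- By normalization of `σ` no scalar is left, so the summand at the identity generates the whole
induced object under the maps `μ^g`. -/
theorem inducedAct_summandIncl_one (g : G) (v : V) :
    inducedAct A y π g (summandIncl π 1 v) = summandIncl π g v := by
  rw [inducedAct_summandIncl, mul_one, A.σ_one_right, inv_one, Units.val_one, one_smul]

theorem sum_summandIncl_summandProj [Fintype (G ⧸ stabilizer G y)] :
    ∑ q : G ⧸ stabilizer G y, summandIncl π (rep y q) ∘ₗ summandProj π (rep y q) =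
      LinearMap.id := by
  classical
  refine LinearMap.pi_ext fun q v => ?_
  rw [LinearMap.sum_apply, Finset.sum_eq_single q, LinearMap.comp_apply, ← summandIncl_rep π,
    summandProj_summandIncl, LinearMap.id_apply]
  · intro p _ hp
    rw [LinearMap.comp_apply, ← summandIncl_rep π, summandProj_summandIncl_of_ne, map_zero]
    rw [rep_mk, rep_mk]
    exact hp.symm
  · intro h
    exact absurd (Finset.mem_univ q) h

/-- Two elements of one coset give projections that differ by an automorphism of `V`; in particular
they have the same kernel. -/
theorem exists_summandProj_eq {t a : G}
    (h : (QuotientGroup.mk a : G ⧸ stabilizer G y) = QuotientGroup.mk t) :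
    ∃ L : V →ₗ[k] V, summandProj π a = L ∘ₗ summandProj π t := by
  refine ⟨(summandEquiv π a).symm.toLinearMap ∘ₗ (summandEquiv π t).toLinearMap, ?_⟩
  ext1 f
  simp [summandProj, h]

/-- The stabilizer of the coset `tG_y` is `tG_yt⁻¹`, which is the stabilizer of `ᵗy`. -/
theorem mk_mul_eq_mk_iff (g t : G) :
    (QuotientGroup.mk (g * t) : G ⧸ stabilizer G y) = QuotientGroup.mk t ↔
      g ∈ stabilizer G (t • y) := by
  rw [eq_comm, QuotientGroup.eq, mem_stabilizer_iff, mem_stabilizer_iff, mul_smul, mul_smul,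
    inv_smul_eq_iff]

theorem smul_eq_of_mk_eq {t a : G}
    (h : (QuotientGroup.mk a : G ⧸ stabilizer G y) = QuotientGroup.mk t) : a • y = t • y := by
  rw [← rep_smul, h, rep_smul]

theorem mk_mul_eq_iff {g t : G} (hg : g ∈ stabilizer G (t • y)) (a : G) :
    (QuotientGroup.mk (g * a) : G ⧸ stabilizer G y) = QuotientGroup.mk t ↔
      (QuotientGroup.mk a : G ⧸ stabilizer G y) = QuotientGroup.mk t := by
  conv_lhs => rw [← (mk_mul_eq_mk_iff g t).2 hg]
  exact (MulAction.injective g).eq_iff (a := (QuotientGroup.mk a : G ⧸ stabilizer G y))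
    (b := QuotientGroup.mk t)

/-- This explains the scalar in `ProjRep.conj`. Since `gt = t(t⁻¹gt)`, the action contributes `σ(g,
t; y)⁻¹` and the return to the representative `t` contributes `σ(t, t⁻¹gt; y)`. -/
theorem inducedAct_summandIncl_conj (t : G) (g : stabilizer G (t • y)) (v : V) :
    inducedAct A y π g (summandIncl π t v) = summandIncl π t ((π.conj A t).toFun g v) := by
  have e : (g : G) * t = t * ((⟨t⁻¹ * g * t, conj_mem t g⟩ : stabilizer G y) : G) := by
    simp [mul_assoc]
  rw [inducedAct_summandIncl, e, summandIncl_mul, smul_smul, ← Units.val_mul, ← div_eq_inv_mul,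
    ← map_smul]
  rfl

end Summands

/-! ### Equivariant structures on underlying spaces, and maps into a homogeneous component -/

section Frobenius

variable {k : Type u} {Γ : Type v} [Field k] [Group Γ] [Fintype Γ] {c : Cocycle3 k Γ}
  {G : Type w} [Group G] [MulDistribMulAction G Γ] {A : ActionData c G}

namespace Equivariant

/-- The map `μ^g`, on the underlying space. -/
def act (X : Equivariant A) (g : G) : X.obj.carrier →ₗ[k] X.obj.carrier :=
  VecGr.lin (V := (A.ρ g).obj X.obj) (X.μ g)

/-- On a homogeneous vector `ρ₂^{g,h}` is a scalar, so the structure equation says that the action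
is projective with factor set `σ_x` in degree `x`. -/
theorem act_act (X : Equivariant A) {g h : G} {x : Γ} {m : X.obj.carrier}
    (hm : X.obj.gr.Deg x m) :
    X.act g (X.act h m) = (((A.σ g h x)⁻¹ : kˣ) : k) • X.act (g * h) m := by
  have e := LinearMap.congr_fun (congrArg VecGr.lin (X.μ_mul g h)) m
  change X.act g (X.act h m) = X.act (g * h) (X.obj.gr.scale₁ (A.σ g h)⁻¹ m) at e
  rw [e, Grading.scale₁_apply _ hm, map_smul, Pi.inv_apply]

theorem act_mul (X : Equivariant A) {g h : G} {x : Γ} {m : X.obj.carrier}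
    (hm : X.obj.gr.Deg x m) :
    X.act (g * h) m = (A.σ g h x : k) • X.act g (X.act h m) := by
  rw [X.act_act hm, smul_smul, Units.mul_inv, one_smul]

theorem act_one (X : Equivariant A) (m : X.obj.carrier) : X.act 1 m = m :=
  LinearMap.congr_fun (congrArg VecGr.lin X.μ_one) m

theorem deg_act (X : Equivariant A) {x : Γ} {m : X.obj.carrier} (hm : X.obj.gr.Deg x m) (g : G) :
    X.obj.gr.Deg (g • x) (X.act g m) :=
  VecGr.lin_deg (X.μ g) (hm.shift g)

theorem under_act {X Y : Equivariant A} (f : X ⟶ Y) (g : G) (m : X.obj.carrier) :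
    VecGr.lin (under f) (X.act g m) = Y.act g (VecGr.lin (under f) m) :=
  LinearMap.congr_fun (congrArg VecGr.lin (under_comm f g)) m

end Equivariant

/-- The `G_x`-equivariant linear maps `V → X` with values in the component of degree `x`. -/
def homogeneousIntertwiners {x : Γ} {V : Type*} [AddCommGroup V] [Module k V]
    (δ : ProjRep k (stabilizer G x) (A.factorSet x) V) (X : Equivariant A) :
    Submodule k (V →ₗ[k] X.obj.carrier) where
  carrier := {φ | (∀ v, X.obj.gr.Deg x (φ v)) ∧
    ∀ (g : stabilizer G x) (v : V), φ (δ.toFun g v) = X.act g (φ v)}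
  zero_mem' := ⟨fun v => by simp [Grading.Deg], fun g v => by simp⟩
  add_mem' {φ ψ} hφ hψ := ⟨fun v => by
      have h₁ := hφ.1 v
      have h₂ := hψ.1 v
      unfold Grading.Deg at *
      rw [LinearMap.add_apply, map_add, h₁, h₂],
    fun g v => by rw [LinearMap.add_apply, LinearMap.add_apply, map_add, hφ.2, hψ.2]⟩
  smul_mem' r φ hφ := ⟨fun v => (hφ.1 v).smul r,
    fun g v => by rw [LinearMap.smul_apply, LinearMap.smul_apply, map_smul, hφ.2]⟩

end Frobenius

/-! ### Frobenius reciprocity for induced objects -/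

section Frobenius

variable {k : Type u} {Γ : Type v} [Field k] [Group Γ] [Fintype Γ] {c : Cocycle3 k Γ}
  {G : Type u} [Group G] [Finite G] [MulDistribMulAction G Γ] {A : ActionData c G} {x : Γ}
  {V : Type u} [AddCommGroup V] [Module k V] [FiniteDimensional k V]
  (δ : ProjRep k (stabilizer G x) (A.factorSet x) V) (X : Equivariant A)

/-- Restriction of an equivariant morphism to the summand of the identity coset. -/
def restrictIdentity : (simpleObj A x δ ⟶ X) →ₗ[k] homogeneousIntertwiners δ X where
  toFun F := ⟨VecGr.lin (Equivariant.under F) ∘ₗ summandIncl δ 1, fun v => by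
      have h := deg_summandIncl δ 1 v
      rw [one_smul] at h
      exact VecGr.lin_deg (Equivariant.under F) h,
    fun g v => by
      -- For `g ∈ G_x` the vector `δ(g)v` in the identity summand is `μ^g` of the vector `v` there,
      -- so equivariance of `F` gives the intertwining property.
      have e := Equivariant.under_act F (g : G) (summandIncl δ 1 v)
      refine Eq.trans ?_ e
      change VecGr.lin (Equivariant.under F) _ =
        VecGr.lin (Equivariant.under F) (inducedAct A x δ g (summandIncl δ 1 v))
      congr 1
      exact (summandIncl_one_apply δ g v).trans (inducedAct_summandIncl_one δ (g : G) v).symm⟩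
  map_add' _ _ := rfl
  map_smul' _ _ := rfl

variable {δ X} in
/-- The linear map `f ↦ ∑_t μ^t(φ(f_t))` extending `φ` to the induced object. -/
def extendIdentityLin (φ : V →ₗ[k] X.obj.carrier) :
    ((G ⧸ stabilizer G x) → V) →ₗ[k] X.obj.carrier := by
  letI : Fintype (G ⧸ stabilizer G x) := Fintype.ofFinite _
  exact ∑ q : G ⧸ stabilizer G x, X.act (rep x q) ∘ₗ φ ∘ₗ LinearMap.proj q

open Classical in
theorem extendIdentityLin_single (φ : V →ₗ[k] X.obj.carrier) (q : G ⧸ stabilizer G x) (v : V) :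
    extendIdentityLin φ (Pi.single q v) = X.act (rep x q) (φ v) := by
  let _ : Fintype (G ⧸ stabilizer G x) := Fintype.ofFinite _
  rw [extendIdentityLin, LinearMap.sum_apply, Finset.sum_eq_single q]
  · simp
  · intro b _ hb
    simp [hb]
  · intro h
    exact absurd (Finset.mem_univ q) h

/-- The extension is independent of the coset representatives: for `t = sh` both `μ^t` on `X_x` and
the inclusion at `t` acquire the factor `σ(s, h; x)`, and `φ` intertwines `δ(h)` with `μ^h`. -/
theorem extendIdentityLin_summandIncl {φ : V →ₗ[k] X.obj.carrier}
    (hφ : φ ∈ homogeneousIntertwiners δ X) (t : G) (v : V) :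
    extendIdentityLin φ (summandIncl δ t v) = X.act t (φ v) := by
  classical
  conv_rhs => rw [← rep_mul_offset x t, X.act_mul (hφ.1 v), ← hφ.2]
  rw [summandIncl_apply, extendIdentityLin_single, summandEquiv_apply, map_smul, map_smul]

/-- Injectivity: an equivariant map that vanishes on the identity summand vanishes on its images
under all `μ^t`, and these span. Surjectivity: the extension sends the vector `v` at `t` to `μ^t
φ(v)`, which has degree `ᵗx` as required. -/
theorem restrictIdentity_bijective : Function.Bijective (restrictIdentity δ X) := by
  constructor
  · rw [← LinearMap.ker_eq_bot, LinearMap.ker_eq_bot']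
    intro F hF
    refine Equivariant.hom_ext (VecGr.hom_ext (ext_summandIncl δ fun t v => ?_))
    have h : VecGr.lin (Equivariant.under F) (summandIncl δ 1 v) = 0 :=
      LinearMap.congr_fun (congrArg Subtype.val hF) v
    have e := Equivariant.under_act F t (summandIncl δ 1 v)
    rw [h, map_zero] at e
    change VecGr.lin (Equivariant.under F) (inducedAct A x δ t (summandIncl δ 1 v)) = 0 at e
    rw [inducedAct_summandIncl_one] at e
    exact e
  · rintro ⟨φ, hφ⟩
    refine ⟨Equivariant.mkHom (X := simpleObj A x δ) (VecGr.mkHom (V := (simpleObj A x δ).obj)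
      (extendIdentityLin φ) ?_) fun g => VecGr.hom_ext (ext_summandIncl δ fun t v => ?_), ?_⟩
    -- Preservation of degrees becomes commutation with the projections, an equation of linear maps
    -- that can be tested on the summands.
    · apply Grading.comm_of_ext
      intro z
      refine ext_summandIncl δ fun t v => ?_
      change extendIdentityLin φ ((inducedGrading k x V).proj z (summandIncl δ t v)) =
        X.obj.gr.proj z (extendIdentityLin φ (summandIncl δ t v))
      rw [extendIdentityLin_summandIncl δ X hφ, (deg_summandIncl δ t v).proj,
        (X.deg_act (hφ.1 v) t).proj]
      split_ifs
      · rw [extendIdentityLin_summandIncl δ X hφ]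
      · rw [map_zero]
    · change extendIdentityLin φ (inducedAct A x δ g (summandIncl δ t v)) =
        X.act g (extendIdentityLin φ (summandIncl δ t v))
      -- Both sides equal `σ(g, t; x)⁻¹ μ^{gt} φ(v)`: source and target carry the same scalar
      -- because `φ(v)` has degree `x`.
      rw [inducedAct_summandIncl, map_smul, extendIdentityLin_summandIncl δ X hφ,
        extendIdentityLin_summandIncl δ X hφ, X.act_act (hφ.1 v)]
    · apply Subtype.ext
      ext v
      change extendIdentityLin φ (summandIncl δ 1 v) = φ v
      rw [extendIdentityLin_summandIncl δ X hφ, X.act_one]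

/-- Frobenius reciprocity for the induced objects `S_{x,δ}`. -/
def frobeniusEquiv : (simpleObj A x δ ⟶ X) ≃ₗ[k] homogeneousIntertwiners δ X :=
  LinearEquiv.ofBijective _ (restrictIdentity_bijective δ X)

end Frobenius

/-! ### Summands of a tensor product of two induced objects -/

section TensorProducts

variable {k : Type u} {Γ : Type v} [Field k] [Group Γ] [Fintype Γ] {c : Cocycle3 k Γ}
  {G : Type u} [Group G] [MulDistribMulAction G Γ] {A : ActionData c G} {x y z : Γ}
  {V₁ V₂ V₃ : Type u} [AddCommGroup V₁] [Module k V₁] [AddCommGroup V₂] [Module k V₂]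
  [AddCommGroup V₃] [Module k V₃]
  (δ : ProjRep k (stabilizer G x) (A.factorSet x) V₁)
  (π : ProjRep k (stabilizer G y) (A.factorSet y) V₂)
  (γ : ProjRep k (stabilizer G z) (A.factorSet z) V₃)

/-- The inclusion of `ρ^t(V_π ⊗ y) ⊗ ρ^s(V_γ ⊗ z)` into `S_{y,π} ⊗ S_{z,γ}`. -/
def tensorIncl (t s : G) : V₂ ⊗[k] V₃ →ₗ[k]
    ((G ⧸ stabilizer G y) → V₂) ⊗[k] ((G ⧸ stabilizer G z) → V₃) :=
  TensorProduct.map (summandIncl π t) (summandIncl γ s)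

/-- The projection of `S_{y,π} ⊗ S_{z,γ}` to `ρ^t(V_π ⊗ y) ⊗ ρ^s(V_γ ⊗ z)`. -/
def tensorProj (t s : G) : ((G ⧸ stabilizer G y) → V₂) ⊗[k] ((G ⧸ stabilizer G z) → V₃) →ₗ[k]
    V₂ ⊗[k] V₃ :=
  TensorProduct.map (summandProj π t) (summandProj γ s)

/-- The equivariant structure of `S_{y,π} ⊗ S_{z,γ}`. -/
def tensorAct (g : G) : ((G ⧸ stabilizer G y) → V₂) ⊗[k] ((G ⧸ stabilizer G z) → V₃) →ₗ[k]
    ((G ⧸ stabilizer G y) → V₂) ⊗[k] ((G ⧸ stabilizer G z) → V₃) :=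
  TensorProduct.map (inducedAct A y π g) (inducedAct A z γ g) ∘ₗ
    (inducedGrading k y V₂).scale₂ (inducedGrading k z V₃) (A.τ g)⁻¹

variable (k G V₂ V₃ y z) in
/-- The grading of `S_{y,π} ⊗ S_{z,γ}`. -/
def tensorGrading :
    Grading k Γ (((G ⧸ stabilizer G y) → V₂) ⊗[k] ((G ⧸ stabilizer G z) → V₃)) :=
  (inducedGrading k y V₂).tensor (inducedGrading k z V₃)

theorem tensorIncl_tmul (t s : G) (v : V₂) (w : V₃) :
    tensorIncl π γ t s (v ⊗ₜ w) = summandIncl π t v ⊗ₜ summandIncl γ s w := rfl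

theorem tensorAct_tmul (g a b : G) (v : V₂) (w : V₃) :
    tensorAct π γ g (tensorIncl π γ a b (v ⊗ₜ w)) =
      (((A.τ g (a • y) (b • z))⁻¹ : kˣ) : k) •
        (inducedAct A y π g (summandIncl π a v) ⊗ₜ[k] inducedAct A z γ g (summandIncl γ b w)) := by
  rw [tensorAct, LinearMap.comp_apply, tensorIncl_tmul,
    Grading.scale₂_apply _ (deg_summandIncl π a v) (deg_summandIncl γ b w), map_smul,
    TensorProduct.map_tmul]
  rfl

/-- The action permutes the summands through the diagonal translation of pairs. The scalar collects
the monoidal structure of `ρ^g` and the two factors from the induced objects. -/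
theorem tensorAct_tensorIncl (g a b : G) (u : V₂ ⊗[k] V₃) :
    tensorAct π γ g (tensorIncl π γ a b u) =
      (((A.τ g (a • y) (b • z) * A.σ g a y * A.σ g b z)⁻¹ : kˣ) : k) •
        tensorIncl π γ (g * a) (g * b) u := by
  refine LinearMap.congr_fun (f := tensorAct π γ g ∘ₗ tensorIncl π γ a b)
    (g := (((A.τ g (a • y) (b • z) * A.σ g a y * A.σ g b z)⁻¹ : kˣ) : k) •
      tensorIncl π γ (g * a) (g * b)) (TensorProduct.ext' fun v w => ?_) u
  rw [LinearMap.comp_apply, tensorAct_tmul, inducedAct_summandIncl, inducedAct_summandIncl,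
    LinearMap.smul_apply, tensorIncl_tmul, TensorProduct.tmul_smul, ← TensorProduct.smul_tmul',
    smul_smul, smul_smul, ← Units.val_mul, ← Units.val_mul]
  congr 2
  rw [mul_inv, mul_inv, mul_assoc, mul_assoc, mul_comm (A.σ g b z)⁻¹]

/-- An element that fixes both cosets acts within the summand: each factor acts by its conjugate
representation, and `ρ₂^g` of the tensor product supplies `τ⁻¹`. -/
theorem tensorAct_tensorIncl_twist {t s : G} (hx : x = (t • y) * (s • z))
    (g : (stabilizer G (t • y) ⊓ stabilizer G (s • z) : Subgroup G)) (u : V₂ ⊗[k] V₃) :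
    tensorAct π γ g (tensorIncl π γ t s u) =
      tensorIncl π γ t s ((ProjRep.tensorTwist A hx (π.conj A t) (γ.conj A s)).toFun g u) := by
  refine LinearMap.congr_fun (f := tensorAct π γ g ∘ₗ tensorIncl π γ t s)
    (g := tensorIncl π γ t s ∘ₗ (ProjRep.tensorTwist A hx (π.conj A t) (γ.conj A s)).toFun g)
    (TensorProduct.ext' fun v w => ?_) u
  have h₁ := inducedAct_summandIncl_conj π t ⟨g, g.2.1⟩ v
  have h₂ := inducedAct_summandIncl_conj γ s ⟨g, g.2.2⟩ w
  rw [LinearMap.comp_apply, tensorAct_tmul, h₁, h₂, LinearMap.comp_apply,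
    ← tensorIncl_tmul, ← map_smul]
  rfl

theorem deg_tensorIncl (t s : G) (u : V₂ ⊗[k] V₃) :
    (tensorGrading k G y z V₂ V₃).Deg (t • y * s • z) (tensorIncl π γ t s u) := by
  refine LinearMap.congr_fun
    (f := (tensorGrading k G y z V₂ V₃).proj (t • y * s • z) ∘ₗ tensorIncl π γ t s)
    (g := tensorIncl π γ t s) (TensorProduct.ext' fun v w => ?_) u
  exact (deg_summandIncl π t v).tmul (deg_summandIncl γ s w)

theorem tensorProj_tensorIncl (t s : G) (u : V₂ ⊗[k] V₃) :
    tensorProj π γ t s (tensorIncl π γ t s u) = u := by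
  refine LinearMap.congr_fun (f := tensorProj π γ t s ∘ₗ tensorIncl π γ t s)
    (g := LinearMap.id) (TensorProduct.ext' fun v w => ?_) u
  rw [LinearMap.comp_apply, tensorIncl_tmul, tensorProj, TensorProduct.map_tmul,
    summandProj_summandIncl, summandProj_summandIncl, LinearMap.id_apply]

theorem tensorProj_tensorIncl_of_ne {t s a b : G}
    (h : ¬ ((QuotientGroup.mk a : G ⧸ stabilizer G y) = QuotientGroup.mk t ∧
      (QuotientGroup.mk b : G ⧸ stabilizer G z) = QuotientGroup.mk s)) (u : V₂ ⊗[k] V₃) :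
    tensorProj π γ t s (tensorIncl π γ a b u) = 0 := by
  refine LinearMap.congr_fun (f := tensorProj π γ t s ∘ₗ tensorIncl π γ a b)
    (g := 0) (TensorProduct.ext' fun v w => ?_) u
  rw [LinearMap.comp_apply, tensorIncl_tmul, tensorProj, TensorProduct.map_tmul]
  rcases not_and_or.1 h with h | h
  · rw [summandProj_summandIncl_of_ne π h, TensorProduct.zero_tmul, LinearMap.zero_apply]
  · rw [summandProj_summandIncl_of_ne γ h, TensorProduct.tmul_zero, LinearMap.zero_apply]

theorem ext_tensorIncl [Finite G] {M : Type*} [AddCommMonoid M] [Module k M]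
    {f g : ((G ⧸ stabilizer G y) → V₂) ⊗[k] ((G ⧸ stabilizer G z) → V₃) →ₗ[k] M}
    (h : ∀ a b v w, f (tensorIncl π γ a b (v ⊗ₜ w)) = g (tensorIncl π γ a b (v ⊗ₜ w))) :
    f = g := by
  apply TensorProduct.ext
  refine ext_summandIncl π fun a v => ext_summandIncl γ fun b w => h a b v w

/-- The projection counterpart of `tensorAct_tensorIncl_twist`: an element that fixes the pair of
cosets permutes the other pairs among themselves, so nothing from another summand enters. -/
theorem tensorProj_tensorAct_twist [Finite G] {t s : G} (hx : x = (t • y) * (s • z))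
    (g : (stabilizer G (t • y) ⊓ stabilizer G (s • z) : Subgroup G))
    (m : ((G ⧸ stabilizer G y) → V₂) ⊗[k] ((G ⧸ stabilizer G z) → V₃)) :
    tensorProj π γ t s (tensorAct π γ g m) =
      (ProjRep.tensorTwist A hx (π.conj A t) (γ.conj A s)).toFun g (tensorProj π γ t s m) := by
  refine LinearMap.congr_fun (f := tensorProj π γ t s ∘ₗ tensorAct π γ g)
    (g := (ProjRep.tensorTwist A hx (π.conj A t) (γ.conj A s)).toFun g ∘ₗ tensorProj π γ t s)
    (ext_tensorIncl π γ fun a b v w => ?_) m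
  rw [LinearMap.comp_apply, LinearMap.comp_apply]
  by_cases h : (QuotientGroup.mk a : G ⧸ stabilizer G y) = QuotientGroup.mk t ∧
      (QuotientGroup.mk b : G ⧸ stabilizer G z) = QuotientGroup.mk s
  · obtain ⟨v', hv⟩ := exists_summandIncl_eq π h.1 v
    obtain ⟨w', hw⟩ := exists_summandIncl_eq γ h.2 w
    rw [tensorIncl_tmul, hv, hw, ← tensorIncl_tmul, tensorAct_tensorIncl_twist π γ hx,
      tensorProj_tensorIncl, tensorProj_tensorIncl]
  · rw [tensorProj_tensorIncl_of_ne π γ h, tensorAct_tensorIncl, map_smul,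
      tensorProj_tensorIncl_of_ne π γ, smul_zero, map_zero]
    rwa [mk_mul_eq_iff g.2.1, mk_mul_eq_iff g.2.2]

/-- The components of a vector at `(t, s)` and of its `g`-translate at `(gt, gs)` agree up to an
invertible scalar, so vanishing of components propagates along orbits. -/
theorem tensorProj_mul_tensorAct [Finite G] (g t s : G)
    (m : ((G ⧸ stabilizer G y) → V₂) ⊗[k] ((G ⧸ stabilizer G z) → V₃)) :
    tensorProj π γ (g * t) (g * s) (tensorAct π γ g m) =
      (((A.τ g (t • y) (s • z) * A.σ g t y * A.σ g s z)⁻¹ : kˣ) : k) •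
        tensorProj π γ t s m := by
  refine LinearMap.congr_fun (f := tensorProj π γ (g * t) (g * s) ∘ₗ tensorAct π γ g)
    (g := (((A.τ g (t • y) (s • z) * A.σ g t y * A.σ g s z)⁻¹ : kˣ) : k) • tensorProj π γ t s)
    (ext_tensorIncl π γ fun a b v w => ?_) m
  rw [LinearMap.comp_apply, LinearMap.smul_apply]
  by_cases h : (QuotientGroup.mk a : G ⧸ stabilizer G y) = QuotientGroup.mk t ∧
      (QuotientGroup.mk b : G ⧸ stabilizer G z) = QuotientGroup.mk s
  · obtain ⟨v', hv⟩ := exists_summandIncl_eq π h.1 v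
    obtain ⟨w', hw⟩ := exists_summandIncl_eq γ h.2 w
    rw [tensorIncl_tmul, hv, hw, ← tensorIncl_tmul, tensorAct_tensorIncl, map_smul,
      tensorProj_tensorIncl, tensorProj_tensorIncl]
  · rw [tensorProj_tensorIncl_of_ne π γ h, tensorAct_tensorIncl, map_smul,
      tensorProj_tensorIncl_of_ne π γ, smul_zero, smul_zero]
    intro h'
    refine h ⟨MulAction.injective g h'.1, MulAction.injective g h'.2⟩

theorem tensorProj_eq_zero_of_mk_eq {t s a b : G}
    (h₁ : (QuotientGroup.mk a : G ⧸ stabilizer G y) = QuotientGroup.mk t)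
    (h₂ : (QuotientGroup.mk b : G ⧸ stabilizer G z) = QuotientGroup.mk s)
    {m : ((G ⧸ stabilizer G y) → V₂) ⊗[k] ((G ⧸ stabilizer G z) → V₃)}
    (hm : tensorProj π γ t s m = 0) : tensorProj π γ a b m = 0 := by
  obtain ⟨L₁, e₁⟩ := exists_summandProj_eq π h₁
  obtain ⟨L₂, e₂⟩ := exists_summandProj_eq γ h₂
  rw [tensorProj, e₁, e₂, TensorProduct.map_comp, LinearMap.comp_apply]
  rw [tensorProj] at hm
  rw [hm, map_zero]

theorem tensorProj_eq_zero_of_deg [Finite G] {t s : G} (hx : x ≠ (t • y) * (s • z))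
    {m : ((G ⧸ stabilizer G y) → V₂) ⊗[k] ((G ⧸ stabilizer G z) → V₃)}
    (hm : (tensorGrading k G y z V₂ V₃).Deg x m) : tensorProj π γ t s m = 0 := by
  -- Replacing `m` by its degree `x` part makes the claim linear in `m`, so that it can be tested on
  -- the summands; only those of degree `x` survive, and that of `(t, s)` is not among them.
  rw [← hm]
  refine LinearMap.congr_fun (f := tensorProj π γ t s ∘ₗ (tensorGrading k G y z V₂ V₃).proj x)
    (g := 0) (ext_tensorIncl π γ fun a b v w => ?_) m
  rw [LinearMap.comp_apply, (deg_tensorIncl π γ a b _).proj, LinearMap.zero_apply]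
  split_ifs with h
  · refine tensorProj_tensorIncl_of_ne π γ (fun h' => hx ?_) _
    rw [h, smul_eq_of_mk_eq h'.1, smul_eq_of_mk_eq h'.2]
  · rw [map_zero]

/-- The identity of the tensor product is the sum, over pairs of cosets, of projection followed by
inclusion. -/
theorem eq_zero_of_tensorProj_eq_zero [Finite G]
    {m : ((G ⧸ stabilizer G y) → V₂) ⊗[k] ((G ⧸ stabilizer G z) → V₃)}
    (hm : ∀ t s, tensorProj π γ t s m = 0) : m = 0 := by
  let _ : Fintype (G ⧸ stabilizer G y) := Fintype.ofFinite _
  let _ : Fintype (G ⧸ stabilizer G z) := Fintype.ofFinite _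
  have e : ∑ p : G ⧸ stabilizer G y, ∑ q : G ⧸ stabilizer G z,
      tensorIncl π γ (rep y p) (rep z q) ∘ₗ tensorProj π γ (rep y p) (rep z q) =
        LinearMap.id := by
    apply TensorProduct.ext'
    intro f f'
    have h₁ := LinearMap.congr_fun (sum_summandIncl_summandProj π) f
    have h₂ := LinearMap.congr_fun (sum_summandIncl_summandProj γ) f'
    rw [LinearMap.sum_apply, LinearMap.id_apply] at h₁ h₂
    conv_rhs => rw [LinearMap.id_apply, ← h₁, ← h₂, TensorProduct.sum_tmul]
    simp only [LinearMap.sum_apply, TensorProduct.tmul_sum]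
    rfl
  have h := LinearMap.congr_fun e m
  rw [LinearMap.id_apply] at h
  rw [← h]
  simp [LinearMap.sum_apply, hm]

end TensorProducts

/-! ### Inverses of the operators of a projective representation -/

theorem ProjRep.toFun_mul_apply {k : Type u} [Field k] {G : Type w} [Group G] {H : Subgroup G}
    {α : G → G → kˣ} {V : Type*} [AddCommGroup V] [Module k V] (π : ProjRep k H α V)
    (g h : H) (v : V) : π.toFun (g * h) v = (α g h : k) • π.toFun g (π.toFun h v) :=
  LinearMap.congr_fun (π.map_mul g h) v

/-- The invertible maps of a projective representation. -/
def ProjRep.equiv {k : Type u} [Field k] {G : Type w} [Group G] {H : Subgroup G}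
    {α : G → G → kˣ} {V : Type*} [AddCommGroup V] [Module k V] (π : ProjRep k H α V)
    (g : H) : V ≃ₗ[k] V :=
  LinearEquiv.ofBijective (π.toFun g) (π.bijective g)

theorem ProjRep.toFun_equiv_symm {k : Type u} [Field k] {G : Type w} [Group G] {H : Subgroup G}
    {α : G → G → kˣ} {V : Type*} [AddCommGroup V] [Module k V] (π : ProjRep k H α V)
    (g : H) (v : V) : π.toFun g ((π.equiv g).symm v) = v :=
  (π.equiv g).apply_symm_apply v

/-- From `π(gh) = α(g, h) π(g) π(h)`. The factor `α(g, h)⁻¹` is what later balances the scalar of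
two successive actions in `tensorAct_translate`. -/
theorem ProjRep.equiv_symm_mul {k : Type u} [Field k] {G : Type w} [Group G] {H : Subgroup G}
    {α : G → G → kˣ} {V : Type*} [AddCommGroup V] [Module k V] (π : ProjRep k H α V)
    (g h : H) (v : V) : (π.equiv (g * h)).symm (π.toFun g v) =
      (((α g h)⁻¹ : kˣ) : k) • (π.equiv h).symm v := by
  apply (π.equiv (g * h)).injective
  rw [LinearEquiv.apply_symm_apply, map_smul]
  change _ = _ • π.toFun (g * h) _
  rw [π.toFun_mul_apply, π.toFun_equiv_symm, smul_smul, Units.inv_mul, one_smul]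

theorem ProjRep.free_intertwiners {k : Type u} [Field k] {G : Type w} [Group G] {H : Subgroup G}
    {α : G → G → kˣ} {V W : Type*} [AddCommGroup V] [Module k V] [AddCommGroup W] [Module k W]
    (π' : ProjRep k H α V) (π : ProjRep k H α W) : Module.Free k (intertwiners π' π) :=
  inferInstance

/-! ### Decomposition over the orbits of pairs of cosets, and the dimension count -/

section TensorProducts

variable {k : Type u} {Γ : Type v} [Field k] [Group Γ] [Fintype Γ] {c : Cocycle3 k Γ}
  {G : Type u} [Group G] [Finite G] [MulDistribMulAction G Γ] {A : ActionData c G} {x y z : Γ}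
  {V₁ V₂ V₃ : Type u} [AddCommGroup V₁] [Module k V₁] [AddCommGroup V₂] [Module k V₂]
  [AddCommGroup V₃] [Module k V₃] [FiniteDimensional k V₁] [FiniteDimensional k V₂]
  [FiniteDimensional k V₃]
  (δ : ProjRep k (stabilizer G x) (A.factorSet x) V₁)
  (π : ProjRep k (stabilizer G y) (A.factorSet y) V₂)
  (γ : ProjRep k (stabilizer G z) (A.factorSet z) V₃)

/-- True by unfolding: the categorical tensor product carries exactly the grading and action written
out above, so what remains is linear algebra. -/
theorem mem_homogeneousIntertwiners_tensor
    {φ : V₁ →ₗ[k] ((G ⧸ stabilizer G y) → V₂) ⊗[k] ((G ⧸ stabilizer G z) → V₃)} :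
    φ ∈ homogeneousIntertwiners δ (simpleObj A y π ⊗ simpleObj A z γ) ↔
      (∀ v, (tensorGrading k G y z V₂ V₃).Deg x (φ v)) ∧
        ∀ (g : stabilizer G x) (v : V₁), φ (δ.toFun g v) = tensorAct π γ g (φ v) :=
  Iff.rfl

/-- No computation with `τ` is needed, since the tensor product is already an equivariant object. -/
theorem tensorAct_tensorAct {g h : G}
    {m : ((G ⧸ stabilizer G y) → V₂) ⊗[k] ((G ⧸ stabilizer G z) → V₃)}
    (hm : (tensorGrading k G y z V₂ V₃).Deg x m) :
    tensorAct π γ g (tensorAct π γ h m) =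
      (((A.σ g h x)⁻¹ : kˣ) : k) • tensorAct π γ (g * h) m :=
  Equivariant.act_act (simpleObj A y π ⊗ simpleObj A z γ) hm

theorem deg_tensorAct {g : G}
    {m : ((G ⧸ stabilizer G y) → V₂) ⊗[k] ((G ⧸ stabilizer G z) → V₃)}
    (hm : (tensorGrading k G y z V₂ V₃).Deg x m) :
    (tensorGrading k G y z V₂ V₃).Deg (g • x) (tensorAct π γ g m) :=
  Equivariant.deg_act (simpleObj A y π ⊗ simpleObj A z γ) hm g

/-- The intertwiners attached to a pair `(t, s)`. -/
abbrev pairIntertwiners (r : AdmissiblePair G x y z) :=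
  ProjRep.intertwiners (δ.restrict (inertia_inf_le r.2))
    (ProjRep.tensorTwist A r.2 (π.conj A r.1.1) (γ.conj A r.1.2))

/-- The component at a pair `(t, s)` of an equivariant map to `S_{y,π} ⊗ S_{z,γ}`. -/
def pairComponent (r : AdmissiblePair G x y z) :
    homogeneousIntertwiners δ (simpleObj A y π ⊗ simpleObj A z γ) →ₗ[k]
      pairIntertwiners δ π γ r where
  -- The map `φ` intertwines all of `G_x`, and the projection commutes with the subgroup fixing the
  -- pair.
  toFun φ := ⟨tensorProj π γ r.1.1 r.1.2 ∘ₗ φ.1, fun g => by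
    ext v
    have h := (mem_homogeneousIntertwiners_tensor δ π γ).1 φ.2
    refine Eq.trans ?_ (tensorProj_tensorAct_twist π γ r.2 g _)
    exact congrArg (tensorProj π γ r.1.1 r.1.2) (h.2 ⟨g, inertia_inf_le r.2 g.2⟩ v)⟩
  map_add' φ ψ := Subtype.ext (LinearMap.comp_add _ _ _)
  map_smul' a φ := Subtype.ext (LinearMap.comp_smul _ _ _)

/-- The components of an equivariant map at a set of pairs. -/
def pairComponents (R : Finset (AdmissiblePair G x y z)) :
    homogeneousIntertwiners δ (simpleObj A y π ⊗ simpleObj A z γ) →ₗ[k]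
      ∀ r : R, pairIntertwiners δ π γ r.1 :=
  LinearMap.pi fun r => pairComponent δ π γ r.1

theorem pairComponents_injective {R : Finset (AdmissiblePair G x y z)}
    (hR : IsOrbitTransversal R) : Function.Injective (pairComponents δ π γ R) := by
  refine (injective_iff_map_eq_zero (pairComponents δ π γ R)).2 ?_
  rintro ⟨φ, hφ'⟩ h0
  have hφ := (mem_homogeneousIntertwiners_tensor δ π γ).1 hφ'
  have hr : ∀ r ∈ R, ∀ v, tensorProj π γ r.1.1 r.1.2 (φ v) = 0 := fun r hr v =>
    LinearMap.congr_fun (congrArg Subtype.val (congrFun h0 ⟨r, hr⟩)) v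
  refine Subtype.ext (LinearMap.ext fun v => ?_)
  refine eq_zero_of_tensorProj_eq_zero π γ fun a b => ?_
  by_cases hx : x = (a • y) * (b • z)
  · obtain ⟨r, ⟨hrR, g, hg, e₁, e₂⟩, -⟩ := hR ⟨(a, b), hx⟩
    have e := tensorProj_mul_tensorAct π γ g a b (φ v)
    -- The pair `(ga, gb)` indexes the same summand as `r`, and there the component of `μ^g φ(v) =
    -- φ(δ(g)v)` vanishes by assumption.
    rw [tensorProj_eq_zero_of_mk_eq π γ e₁ e₂ ?_] at e
    · exact (smul_eq_zero_iff_right (Units.ne_zero _)).1 e.symm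
    · exact (congrArg (tensorProj π γ r.1.1 r.1.2) (hφ.2 ⟨g, hg⟩ v)).symm.trans (hr r hrR _)
  · exact tensorProj_eq_zero_of_deg π γ hx (hφ.1 v)

variable [CharZero k]

open Classical in
/-- The stabilizer in `G_x` of the cosets of a pair `(t, s)`. -/
def pairStabilizer [Fintype (stabilizer G x)] (r : AdmissiblePair G x y z) :
    Finset (stabilizer G x) :=
  {g | (QuotientGroup.mk ((g : G) * r.1.1) : G ⧸ stabilizer G y) = QuotientGroup.mk r.1.1 ∧
    (QuotientGroup.mk ((g : G) * r.1.2) : G ⧸ stabilizer G z) = QuotientGroup.mk r.1.2}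

theorem mem_pairStabilizer [Fintype (stabilizer G x)] {r : AdmissiblePair G x y z}
    {g : stabilizer G x} : g ∈ pairStabilizer r ↔
      (QuotientGroup.mk ((g : G) * r.1.1) : G ⧸ stabilizer G y) = QuotientGroup.mk r.1.1 ∧
      (QuotientGroup.mk ((g : G) * r.1.2) : G ⧸ stabilizer G z) = QuotientGroup.mk r.1.2 := by
  simp [pairStabilizer]

/-- The stabilizer contains `1`, and characteristic zero keeps its order nonzero in `k`. This
permits the averaging in `pairComponents_surjective`. -/
theorem card_pairStabilizer_ne_zero [Fintype (stabilizer G x)] (r : AdmissiblePair G x y z) :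
    ((pairStabilizer r).card : k) ≠ 0 := by
  rw [Nat.cast_ne_zero, Finset.card_ne_zero]
  exact ⟨1, mem_pairStabilizer.2 ⟨by simp, by simp⟩⟩

variable {δ π γ}

/-- The `g`-translate of an intertwiner attached to `(t, s)`, with values in the summand of
`(gt, gs)`. -/
def translate (r : AdmissiblePair G x y z) (ψ : V₁ →ₗ[k] V₂ ⊗[k] V₃)
    (δ : ProjRep k (stabilizer G x) (A.factorSet x) V₁)
    (π : ProjRep k (stabilizer G y) (A.factorSet y) V₂)
    (γ : ProjRep k (stabilizer G z) (A.factorSet z) V₃) (g : stabilizer G x) :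
    V₁ →ₗ[k] ((G ⧸ stabilizer G y) → V₂) ⊗[k] ((G ⧸ stabilizer G z) → V₃) :=
  tensorAct π γ g ∘ₗ tensorIncl π γ r.1.1 r.1.2 ∘ₗ ψ ∘ₗ (δ.equiv g).symm.toLinearMap

theorem translate_apply (r : AdmissiblePair G x y z) (ψ : V₁ →ₗ[k] V₂ ⊗[k] V₃)
    (g : stabilizer G x) (v : V₁) : translate r ψ δ π γ g v =
      tensorAct π γ g (tensorIncl π γ r.1.1 r.1.2 (ψ ((δ.equiv g).symm v))) := rfl

theorem deg_tensorIncl_pair (r : AdmissiblePair G x y z) (u : V₂ ⊗[k] V₃) :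
    (tensorGrading k G y z V₂ V₃).Deg x (tensorIncl π γ r.1.1 r.1.2 u) := by
  have h := deg_tensorIncl π γ r.1.1 r.1.2 u
  rwa [← r.2] at h

theorem deg_translate (r : AdmissiblePair G x y z) (ψ : V₁ →ₗ[k] V₂ ⊗[k] V₃)
    (g : stabilizer G x) (v : V₁) :
    (tensorGrading k G y z V₂ V₃).Deg x (translate r ψ δ π γ g v) := by
  have h := deg_tensorAct π γ (g := g)
    (deg_tensorIncl_pair (π := π) (γ := γ) r (ψ ((δ.equiv g).symm v)))
  rwa [mem_stabilizer_iff.1 g.2] at h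

/-- The factor `σ(g, h; x)⁻¹` appears on both sides: on the left from inverting `δ(gh)`, on the
right from composing the actions on vectors of degree `x`. Hence translates are permuted with no
leftover scalar. -/
theorem tensorAct_translate (r : AdmissiblePair G x y z) (ψ : V₁ →ₗ[k] V₂ ⊗[k] V₃)
    (g h : stabilizer G x) (v : V₁) :
    translate r ψ δ π γ (g * h) (δ.toFun g v) = tensorAct π γ g (translate r ψ δ π γ h v) := by
  rw [translate_apply, translate_apply, δ.equiv_symm_mul, map_smul, map_smul, map_smul,
    tensorAct_tensorAct π γ (deg_tensorIncl_pair r _)]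
  rfl

/-- On the stabilizer of the pair the action is the twisted tensor product, and the intertwining
property of `ψ` cancels it against the inverse of `δ(g)`. -/
theorem translate_of_mem [Fintype (stabilizer G x)] {r : AdmissiblePair G x y z}
    (ψ : pairIntertwiners δ π γ r) {g : stabilizer G x} (hg : g ∈ pairStabilizer r) (v : V₁) :
    translate r ψ.1 δ π γ g v = tensorIncl π γ r.1.1 r.1.2 (ψ.1 v) := by
  rw [mem_pairStabilizer, mk_mul_eq_mk_iff, mk_mul_eq_mk_iff] at hg
  have e := LinearMap.congr_fun (ψ.2 ⟨g, hg⟩) ((δ.equiv g).symm v)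
  have e' := tensorAct_tensorIncl_twist π γ r.2 ⟨g, hg⟩ (ψ.1 ((δ.equiv g).symm v))
  rw [translate_apply]
  refine e'.trans (congrArg (tensorIncl π γ r.1.1 r.1.2) (e.symm.trans ?_))
  exact congrArg ψ.1 (δ.toFun_equiv_symm g v)

theorem tensorProj_translate_of_ne {r r' : AdmissiblePair G x y z}
    (ψ : V₁ →ₗ[k] V₂ ⊗[k] V₃) {g : stabilizer G x}
    (h : ¬ ((QuotientGroup.mk ((g : G) * r.1.1) : G ⧸ stabilizer G y) = QuotientGroup.mk r'.1.1 ∧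
      (QuotientGroup.mk ((g : G) * r.1.2) : G ⧸ stabilizer G z) = QuotientGroup.mk r'.1.2))
    (v : V₁) : tensorProj π γ r'.1.1 r'.1.2 (translate r ψ δ π γ g v) = 0 := by
  rw [translate_apply, tensorAct_tensorIncl, map_smul, tensorProj_tensorIncl_of_ne π γ h,
    smul_zero]

theorem pairComponents_surjective {R : Finset (AdmissiblePair G x y z)}
    (hR : IsOrbitTransversal R) : Function.Surjective (pairComponents δ π γ R) := by
  classical
  intro ψ
  let _ : Fintype (stabilizer G x) := Fintype.ofFinite _
  -- Each `ψ r` is spread over the orbit of `r` by all of `G_x`. Every summand of the orbit is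
  -- reached once for each element of a coset of the stabilizer, which the factor in front corrects.
  let φ : V₁ →ₗ[k] ((G ⧸ stabilizer G y) → V₂) ⊗[k] ((G ⧸ stabilizer G z) → V₃) :=
    ∑ r : R, ((pairStabilizer r.1).card : k)⁻¹ • ∑ g, translate r.1 (ψ r).1 δ π γ g
  have hφ : ∀ v, φ v = ∑ r : R, ((pairStabilizer r.1).card : k)⁻¹ •
      ∑ g, translate r.1 (ψ r).1 δ π γ g v := fun v => by
    simp only [φ, LinearMap.sum_apply, LinearMap.smul_apply]
  have hmem : φ ∈ homogeneousIntertwiners δ (simpleObj A y π ⊗ simpleObj A z γ) := by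
    rw [mem_homogeneousIntertwiners_tensor]
    constructor
    · intro v
      unfold Grading.Deg
      rw [hφ, map_sum]
      refine Finset.sum_congr rfl fun r _ => ?_
      rw [map_smul, map_sum]
      congr 1
      exact Finset.sum_congr rfl fun g _ => deg_translate r.1 (ψ r).1 g v
    · intro h v
      rw [hφ, hφ, map_sum]
      refine Finset.sum_congr rfl fun r _ => ?_
      rw [map_smul, map_sum]
      congr 1
      -- Reindexing `g ↦ hg` makes the sum of translates equivariant term by term.
      rw [← Equiv.sum_comp (Equiv.mulLeft h)]
      exact Finset.sum_congr rfl fun g _ => tensorAct_translate r.1 (ψ r).1 h g v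
  refine ⟨⟨φ, hmem⟩, funext fun r => Subtype.ext (LinearMap.ext fun v => ?_)⟩
  change tensorProj π γ r.1.1.1 r.1.1.2 (φ v) = (ψ r).1 v
  rw [hφ, map_sum, Finset.sum_eq_single r]
  -- Only the elements fixing the pair `r` contribute to the component at `r`, and each contributes
  -- the same value `ψ r v`.
  · rw [map_smul, map_sum, ← Finset.sum_subset (Finset.subset_univ (pairStabilizer r.1)),
      Finset.sum_congr rfl fun g hg => by
        rw [translate_of_mem (ψ r) hg, tensorProj_tensorIncl],
      Finset.sum_const, ← Nat.cast_smul_eq_nsmul k, smul_smul,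
      inv_mul_cancel₀ (card_pairStabilizer_ne_zero r.1), one_smul]
    intro g _ hg
    rw [mem_pairStabilizer] at hg
    exact tensorProj_translate_of_ne _ hg v
  · intro r' _ hne
    rw [map_smul, map_sum, Finset.sum_eq_zero, smul_zero]
    intro g _
    refine tensorProj_translate_of_ne _ (fun h => hne (Subtype.ext ?_)) v
    -- A nonzero contribution of `r'` at `r` would put both in the orbit of `r'`, through `1` and
    -- `g` respectively, so they would coincide.
    refine (hR r'.1).unique ⟨r'.2, 1, one_mem _, ?_, ?_⟩ ⟨r.2, g, g.2, h.1, h.2⟩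
    · rw [one_mul]
    · rw [one_mul]
  · intro h
    exact absurd (Finset.mem_univ r) h

variable (δ π γ)

theorem finrank_hom_tensor {R : Finset (AdmissiblePair G x y z)} (hR : IsOrbitTransversal R) :
    Module.finrank k (simpleObj A x δ ⟶ simpleObj A y π ⊗ simpleObj A z γ) =
      ∑ r ∈ R, fusionTerm A δ π γ r := by
  have hfree : ∀ r : R, Module.Free k (pairIntertwiners δ π γ r.1) := fun r =>
    ProjRep.free_intertwiners _ _
  have hfin : ∀ r : R, Module.Finite k (pairIntertwiners δ π γ r.1) := fun r =>
    FiniteDimensional.finiteDimensional_submodule _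
  rw [((frobeniusEquiv δ _).trans (LinearEquiv.ofBijective (pairComponents δ π γ R)
    ⟨pairComponents_injective δ π γ hR, pairComponents_surjective hR⟩)).finrank_eq,
    Module.finrank_pi_fintype, ← Finset.sum_coe_sort R]
  rfl

theorem fusionSum_eq_sum (R : Finset (AdmissiblePair G x y z)) :
    fusionSum A δ π γ R = ∑ r ∈ R, fusionTerm A δ π γ r := by
  classical
  -- Finiteness of the set of double cosets turns `∑ᶠ` into an ordinary sum, and the fibres of `(t,
  -- s) ↦ G_y t⁻¹s G_z` partition `R`.
  have : Finite (DoubleCoset.Quotient (stabilizer G y : Set G) (stabilizer G z : Set G)) :=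
    Quotient.finite _
  let _ := Fintype.ofFinite
    (DoubleCoset.Quotient (stabilizer G y : Set G) (stabilizer G z : Set G))
  rw [fusionSum, finsum_eq_sum_of_fintype]
  convert Finset.sum_fiberwise R
    (fun r => DoubleCoset.mk (stabilizer G y) (stabilizer G z) (r.1.1⁻¹ * r.1.2))
    (fusionTerm A δ π γ)

end TensorProducts

/-! ### Transport along linear monoidal equivalences, and the theorem -/

/-- A `k`-linear fully faithful functor induces linear isomorphisms on morphisms. -/
def mapLinearEquiv {k : Type*} [Semiring k] {C : Type*} {D : Type*} [Category* C] [Category* D]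
    [Preadditive C] [Preadditive D] [Linear k C] [Linear k D] (Φ : C ⥤ D) [Φ.Additive]
    [Φ.Linear k] [Φ.Full] [Φ.Faithful] (S T : C) : (S ⟶ T) ≃ₗ[k] (Φ.obj S ⟶ Φ.obj T) :=
  LinearEquiv.ofBijective (Φ.mapLinearMap k) ⟨Φ.map_injective, Φ.map_surjective⟩

end PointedFusion

end

open PointedFusion in
theorem theorem4p1 {k : Type u} [Field k] [IsAlgClosed k] [CharZero k]
    {Γ : Type v} [Group Γ] [Fintype Γ] {G : Type u} [Group G] [Finite G]
    [MulDistribMulAction G Γ] (c : Cocycle3 k Γ) (A : ActionData c G) (x y z : Γ)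
    {V₁ V₂ V₃ : Type u}
    [AddCommGroup V₁] [Module k V₁] [FiniteDimensional k V₁]
    [AddCommGroup V₂] [Module k V₂] [FiniteDimensional k V₂]
    [AddCommGroup V₃] [Module k V₃] [FiniteDimensional k V₃]
    (δ : ProjRep k (MulAction.stabilizer G x) (A.factorSet x) V₁) (hδ : δ.IsIrreducible)
    (π : ProjRep k (MulAction.stabilizer G y) (A.factorSet y) V₂) (hπ : π.IsIrreducible)
    (γ : ProjRep k (MulAction.stabilizer G z) (A.factorSet z) V₃) (hγ : γ.IsIrreducible)
    (R : Finset (AdmissiblePair G x y z)) (hR : IsOrbitTransversal R) :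
    Module.finrank k (simpleObj A x δ ⟶ simpleObj A y π ⊗ simpleObj A z γ) =
        fusionSum A δ π γ R ∧
      ∀ (E : Type w₁) [Category.{w₂} E] [MonoidalCategory E] [Preadditive E] [Linear k E]
        (Φ : E ⥤ Equivariant A) [Φ.Monoidal] [Φ.IsEquivalence] [Φ.Additive] [Φ.Linear k]
        (S₁ S₂ S₃ : E), Nonempty (Φ.obj S₁ ≅ simpleObj A x δ) →
        Nonempty (Φ.obj S₂ ≅ simpleObj A y π) → Nonempty (Φ.obj S₃ ≅ simpleObj A z γ) →
        Module.finrank k (S₁ ⟶ S₂ ⊗ S₃) = fusionSum A δ π γ R := by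
  have h : Module.finrank k (simpleObj A x δ ⟶ simpleObj A y π ⊗ simpleObj A z γ) =
      fusionSum A δ π γ R := by
    rw [fusionSum_eq_sum, finrank_hom_tensor δ π γ hR]
  refine ⟨h, ?_⟩
  rintro E _ _ _ _ Φ _ _ _ _ S₁ S₂ S₃ ⟨e₁⟩ ⟨e₂⟩ ⟨e₃⟩
  rw [← h]
  -- The target `Φ(S₂ ⊗ S₃)` is identified with the tensor product of the simple objects by the
  -- inverse tensorator of `Φ` followed by `e₂ ⊗ e₃`; conjugation by isomorphisms is linear on
  -- morphism spaces.
  exact ((mapLinearEquiv (k := k) Φ S₁ (S₂ ⊗ S₃)).trans (Linear.homCongr k e₁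
    ((Functor.Monoidal.μIso Φ S₂ S₃).symm ≪≫ (e₂ ⊗ᵢ e₃)))).finrank_eq
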